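/- Let $K$ be a field of characteristic different from $2$. An operad means a symmetric operad $(P(n))_{n\ge 1}$ in $K$-vector spaces: $S_n$-modules $P(n)$ with an identity in $P(1)$ and linear compositions $P(m)\otimes P(n_1)\otimes\dots\otimes P(n_m)\to P(n_1+\dots+n_m)$ that are associative, unital and equivariant; morphisms are $S_n$-linear and preserve compositions and the identity. Let $\mathrm{Mag}$ be the free operad on one binary operation $x=x(1\,2)$ without symmetry, and put $y(1\,2)=x(2\,1)$. Define by generators and relations: - $\mathrm{Com}$, the operad of commutative (not necessarily associative) algebras: the quotient of $\mathrm{Mag}$ by the operad ideal generated by $y-x$; let $\nu\in\mathrm{Com}(2)$ be its generator; - $\mathrm{Lie}$, the operad of Lie algebras: the quotient of $\mathrm{Mag}$ by the operad ideal generated by $y+x$ and the Jacobi identity $(ab)c+(bc)a+(ca)b$; let $\mu\in\mathrm{Lie}(2)$ be its generator; - $\mathrm{Lie}\text{-}\mathrm{adm}$, the operad of Lie-admissible algebras: the quotient of $\mathrm{Mag}$ by the operad ideal generated by $$(ab)c-(ba)c-c(ab)+c(ba)+(bc)a-(cb)a-a(bc)+a(cb)+(ca)b-(ac)b-b(ca)+b(ac).$$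 A free product of operads $\mathcal O_1,\mathcal O_2$ is an operad $\mathcal O=\mathcal O_1*\mathcal O_2$ with morphisms $\pi_i:\mathcal O_i\to\mathcal O$ such that for every operad $\mathcal P$ and all morphisms $\psi_i:\mathcal O_i\to\mathcal P$ there is a unique morphism $\psi:\mathcal O\to\mathcal P$ with $\psi_i=\psi\pi_i$ for $i=1,2$. **Theorem.** The operad $\mathrm{Lie}\text{-}\mathrm{adm}$ is isomorphic to the free product $\mathrm{Lie}*\mathrm{Com}$. Precisely: 1. There are morphisms $\mathrm{Lie}\to\mathrm{Lie}\text{-}\mathrm{adm}$, $\mu\mapsto x-y$, and $\mathrm{Com}\to\mathrm{Lie}\text{-}\mathrm{adm}$, $\nu\mapsto x+y$, and with them $\mathrm{Lie}\text{-}\mathrm{adm}$ is a free product of $\mathrm{Lie}$ and $\mathrm{Com}$. 2. For every free product $\mathcal O=\mathrm{Lie}*\mathrm{Com}$ with its morphisms $\pi_1:\mathrm{Lie}\to\mathcal O$ and $\pi_2:\mathrm{Com}\to\mathcal O$, there is an isomorphism of operads $\psi:\mathcal O\to\mathrm{Lie}\text{-}\mathrm{adm}$ with $\psi(\pi_1(\mu))=x-y$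 and $\psi(\pi_2(\nu))=x+y$. -/

import Mathlib

universe u v w v₁ v₂ v₃

/-! ### Symmetric operads in vector spaces -/

/-- Bookkeeping for the two ways of grafting three levels of corollas: both index types enumerate,
lexicographically, the triples `(i, j, l)` with `i : Fin m`, `j : Fin (n i)`, `l : Fin (q i j)`. -/
def graftAssocEquiv {m : ℕ} (n : Fin m → ℕ) (q : ∀ i, Fin (n i) → ℕ) :
    Fin (∑ k : Fin (∑ i, n i), q (finSigmaFinEquiv.symm k).1 (finSigmaFinEquiv.symm k).2) ≃
      Fin (∑ i, ∑ j, q i j) :=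
  finSigmaFinEquiv.symm.trans <|
    (Equiv.sigmaCongrLeft (β := fun p : (i : Fin m) × Fin (n i) => Fin (q p.1 p.2))
      finSigmaFinEquiv.symm).trans <|
    (Equiv.sigmaAssoc fun i j => Fin (q i j)).trans <|
    (Equiv.sigmaCongrRight fun _ => finSigmaFinEquiv).trans finSigmaFinEquiv

/-- The block permutation: block `i` (of size `n (σ i)`) is moved to position `σ i`. -/
def blockEquiv {m m' : ℕ} (σ : Fin m ≃ Fin m') (n : Fin m' → ℕ) :
    Fin (∑ i, n (σ i)) ≃ Fin (∑ i, n i) :=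
  finSigmaFinEquiv.symm.trans <|
    (Equiv.sigmaCongrLeft (β := fun i => Fin (n i)) σ).trans finSigmaFinEquiv

/-- The direct sum `τ₁ ⊕ ⋯ ⊕ τₘ`: permute inside each block. -/
def sumEquiv {m : ℕ} {n n' : Fin m → ℕ} (τ : ∀ i, Fin (n i) ≃ Fin (n' i)) :
    Fin (∑ i, n i) ≃ Fin (∑ i, n' i) :=
  finSigmaFinEquiv.symm.trans <| (Equiv.sigmaCongrRight τ).trans finSigmaFinEquiv

/-- The canonical identification for one block: `∑ i : Fin 1, n = n`. -/
def oneBlockEquiv (n : ℕ) : Fin (∑ _i : Fin 1, n) ≃ Fin n :=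
  finCongr (by simp)

/-- The canonical identification for blocks of size one: `∑ i : Fin m, 1 = m`. -/
def unitBlocksEquiv (m : ℕ) : Fin (∑ _i : Fin m, 1) ≃ Fin m :=
  finCongr (by simp)

/-- A symmetric operad `(P(n))_{n ≥ 1}` in vector spaces over `K`, in classical form.

* The component of arity `0` is required to be the zero space (`subsingleton_zero`), which is the
  same as indexing by `n ≥ 1`: compositions involving it are automatically zero.
* The action of the symmetric groups is `act`. It is indexed by bijections `Fin m ≃ Fin n` (so that
  `m = n`) and not only by permutations of `Fin n`; by functoriality an `act` along an equality
  `m = n` is the transport along that equality, so this is precisely an `S_n`-module for each `n`,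
  but identifications such as `(n₁ + n₂) + n₃ = n₁ + (n₂ + n₃)` need no casts. Substitution-wise,
  `act σ f` is `f (x_{σ 1}, …, x_{σ n})`.
* `comp` is the linear map `γ : P(m) ⊗ P(n₁) ⊗ ⋯ ⊗ P(nₘ) → P(n₁ + ⋯ + nₘ)`. -/
structure SymmOperad (K : Type u) [Field K] where
  obj : ℕ → Type v
  [addCommGroup : ∀ n, AddCommGroup (obj n)]
  [module : ∀ n, Module K (obj n)]
  subsingleton_zero : Subsingleton (obj 0)
  act : ∀ {m n : ℕ}, (Fin m ≃ Fin n) → obj m →ₗ[K] obj n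
  act_refl : ∀ {n : ℕ} (a : obj n), act (Equiv.refl (Fin n)) a = a
  act_trans : ∀ {l m n : ℕ} (σ : Fin l ≃ Fin m) (τ : Fin m ≃ Fin n) (a : obj l),
    act (σ.trans τ) a = act τ (act σ a)
  one : obj 1
  comp : ∀ {m : ℕ} (n : Fin m → ℕ),
    obj m →ₗ[K] MultilinearMap K (fun i => obj (n i)) (obj (∑ i, n i))
  one_comp : ∀ {n : ℕ} (a : obj n),
    act (oneBlockEquiv n) (comp (fun _ : Fin 1 => n) one fun _ => a) = a
  comp_one : ∀ {m : ℕ} (a : obj m),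
    act (unitBlocksEquiv m) (comp (fun _ : Fin m => 1) a fun _ => one) = a
  assoc : ∀ {m : ℕ} (n : Fin m → ℕ) (q : ∀ i, Fin (n i) → ℕ)
    (a : obj m) (b : ∀ i, obj (n i)) (c : ∀ i j, obj (q i j)),
    act (graftAssocEquiv n q)
        (comp _ (comp n a b) fun k => c (finSigmaFinEquiv.symm k).1 (finSigmaFinEquiv.symm k).2) =
      comp _ a fun i => comp (q i) (b i) (c i)
  comp_act_left : ∀ {m m' : ℕ} (σ : Fin m ≃ Fin m') (n : Fin m' → ℕ)
    (a : obj m) (b : ∀ i, obj (n i)),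
    comp n (act σ a) b = act (blockEquiv σ n) (comp (fun i => n (σ i)) a fun i => b (σ i))
  comp_act_right : ∀ {m : ℕ} {n n' : Fin m → ℕ} (τ : ∀ i, Fin (n i) ≃ Fin (n' i))
    (a : obj m) (b : ∀ i, obj (n i)),
    (comp n' a fun i => act (τ i) (b i)) = act (sumEquiv τ) (comp n a b)

namespace SymmOperad

attribute [instance] SymmOperad.addCommGroup SymmOperad.module

variable {K : Type u} [Field K]

/-- A morphism of operads: `S_n`-linear maps preserving the compositions and the identity. -/
@[ext]
structure Hom (P : SymmOperad.{u, v₁} K) (Q : SymmOperad.{u, v₂} K) where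
  app : ∀ n : ℕ, P.obj n →ₗ[K] Q.obj n
  app_act : ∀ {m n : ℕ} (σ : Fin m ≃ Fin n) (a : P.obj m),
    app n (P.act σ a) = Q.act σ (app m a)
  app_one : app 1 P.one = Q.one
  app_comp : ∀ {m : ℕ} (n : Fin m → ℕ) (a : P.obj m) (b : ∀ i, P.obj (n i)),
    app (∑ i, n i) (P.comp n a b) = Q.comp n (app m a) fun i => app (n i) (b i)

/-- The identity morphism. -/
def Hom.id (P : SymmOperad.{u, v₁} K) : Hom P P where
  app _ := LinearMap.id
  app_act _ _ := rfl
  app_one := rfl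
  app_comp _ _ _ := rfl

/-- The composite `ψ ∘ φ`. -/
def Hom.comp {P : SymmOperad.{u, v₁} K} {Q : SymmOperad.{u, v₂} K} {R : SymmOperad.{u, v₃} K}
    (ψ : Hom Q R) (φ : Hom P Q) : Hom P R where
  app n := (ψ.app n).comp (φ.app n)
  app_act σ a := by simp [φ.app_act, ψ.app_act]
  app_one := by simp [φ.app_one, ψ.app_one]
  app_comp n a b := by simp [φ.app_comp, ψ.app_comp]

/-- An isomorphism of operads: a morphism with a two-sided inverse morphism. -/
def Hom.IsIso {P : SymmOperad.{u, v₁} K} {Q : SymmOperad.{u, v₂} K} (ψ : Hom P Q) : Prop :=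
  ∃ φ : Hom Q P, φ.comp ψ = Hom.id P ∧ ψ.comp φ = Hom.id Q

/-- `O`, with the morphisms `π₁ : O₁ → O` and `π₂ : O₂ → O`, is the free product of the operads
`O₁` and `O₂`: every pair of morphisms `ψᵢ : Oᵢ → P` is `ψᵢ = ψ ∘ πᵢ` for a unique `ψ : O → P`. -/
def IsFreeProduct {O₁ : SymmOperad.{u, v₁} K} {O₂ : SymmOperad.{u, v₂} K}
    {O : SymmOperad.{u, v} K} (π₁ : Hom O₁ O) (π₂ : Hom O₂ O) : Prop :=
  ∀ (P : SymmOperad.{u, w} K) (ψ₁ : Hom O₁ P) (ψ₂ : Hom O₂ P),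
    ∃! ψ : Hom O P, ψ.comp π₁ = ψ₁ ∧ ψ.comp π₂ = ψ₂

/-! ### Operad ideals and quotients -/

/-- An operad ideal: `S_n`-invariant subspaces absorbing compositions in every argument. -/
structure OperadIdeal (P : SymmOperad.{u, v} K) where
  carrier : ∀ n : ℕ, Submodule K (P.obj n)
  act_mem : ∀ {m n : ℕ} (σ : Fin m ≃ Fin n) {a : P.obj m},
    a ∈ carrier m → P.act σ a ∈ carrier n
  comp_mem_left : ∀ {m : ℕ} (n : Fin m → ℕ) {a : P.obj m} (b : ∀ i, P.obj (n i)),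
    a ∈ carrier m → P.comp n a b ∈ carrier (∑ i, n i)
  comp_mem_right : ∀ {m : ℕ} (n : Fin m → ℕ) (a : P.obj m) (b : ∀ i, P.obj (n i)) (k : Fin m),
    b k ∈ carrier (n k) → P.comp n a b ∈ carrier (∑ i, n i)

/-- The smallest operad ideal containing the elements `r` (each of them listed with its arity). -/
def idealSpan (P : SymmOperad.{u, v} K) (r : Set (Σ n, P.obj n)) : OperadIdeal P where
  carrier n := ⨅ (I : OperadIdeal P) (_ : ∀ x ∈ r, x.2 ∈ I.carrier x.1), I.carrier n
  act_mem σ a ha := by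
    simp only [Submodule.mem_iInf] at ha ⊢
    exact fun I hI => I.act_mem σ (ha I hI)
  comp_mem_left n a b ha := by
    simp only [Submodule.mem_iInf] at ha ⊢
    exact fun I hI => I.comp_mem_left n b (ha I hI)
  comp_mem_right n a b k hb := by
    simp only [Submodule.mem_iInf] at hb ⊢
    exact fun I hI => I.comp_mem_right n a b k (hb I hI)

namespace OperadIdeal

variable {P : SymmOperad.{u, v} K} (I : OperadIdeal P)

theorem comp_sub_mem {m : ℕ} (n : Fin m → ℕ) {a a' : P.obj m} {b b' : ∀ i, P.obj (n i)}
    (ha : a - a' ∈ I.carrier m) (hb : ∀ i, b i - b' i ∈ I.carrier (n i)) :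
    P.comp n a b - P.comp n a' b' ∈ I.carrier (∑ i, n i) := by
  classical
  have h1 : P.comp n a b - P.comp n a' b ∈ I.carrier (∑ i, n i) := by
    simpa using I.comp_mem_left n b ha
  have h2 : ∀ s : Finset (Fin m),
      P.comp n a' (s.piecewise b b') - P.comp n a' b' ∈ I.carrier (∑ i, n i) := by
    intro s
    induction s using Finset.induction_on with
    | empty => simp
    | insert i s hi ih =>
      have h3 : P.comp n a' ((insert i s).piecewise b b') - P.comp n a' (s.piecewise b b')
          ∈ I.carrier (∑ i, n i) := by
        have e : s.piecewise b b' = Function.update (s.piecewise b b') i (b' i) := by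
          rw [eq_comm, Function.update_eq_self_iff]
          simp [hi]
        rw [Finset.piecewise_insert]
        nth_rewrite 2 [e]
        rw [← MultilinearMap.map_update_sub]
        exact I.comp_mem_right n a' _ i (by simpa using hb i)
      simpa using add_mem h3 ih
  have h4 := h2 Finset.univ
  rw [Finset.piecewise_univ] at h4
  simpa using add_mem h1 h4

/-- The composition maps on the quotient spaces `P(n) / I(n)`. -/
noncomputable def quotientComp {m : ℕ} (n : Fin m → ℕ) :
    (P.obj m ⧸ I.carrier m) →ₗ[K]
      MultilinearMap K (fun i => P.obj (n i) ⧸ I.carrier (n i))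
        (P.obj (∑ i, n i) ⧸ I.carrier (∑ i, n i)) :=
  have key : ∀ (a : P.obj m) (b : ∀ i, P.obj (n i)),
      (I.carrier _).mkQ (P.comp n (Quotient.out ((I.carrier m).mkQ a))
        fun i => Quotient.out ((I.carrier (n i)).mkQ (b i))) =
      (I.carrier _).mkQ (P.comp n a b) := fun a b =>
    (Submodule.Quotient.eq _).2 (I.comp_sub_mem n
      ((Submodule.Quotient.eq _).1 (Quotient.out_eq _))
      fun _ => (Submodule.Quotient.eq _).1 (Quotient.out_eq _))
  have upd : ∀ [DecidableEq (Fin m)] (b : ∀ i, P.obj (n i)) (i : Fin m) (x : P.obj (n i)),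
      Function.update (fun i => (I.carrier (n i)).mkQ (b i)) i ((I.carrier (n i)).mkQ x) =
        fun j => (I.carrier (n j)).mkQ (Function.update b i x j) := fun b i x => by
    funext j
    exact (Function.apply_update (fun j => (I.carrier (n j)).mkQ) b i x j).symm
  { toFun := fun a =>
      { toFun := fun b =>
          (I.carrier _).mkQ (P.comp n (Quotient.out a) fun i => Quotient.out (b i))
        map_update_add' := by
          intro _ b i x y
          obtain ⟨a, rfl⟩ := (I.carrier _).mkQ_surjective a
          choose b' hb' using fun i => (I.carrier (n i)).mkQ_surjective (b i)
          obtain rfl : (fun i => (I.carrier (n i)).mkQ (b' i)) = b := funext hb'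
          obtain ⟨x, rfl⟩ := (I.carrier _).mkQ_surjective x
          obtain ⟨y, rfl⟩ := (I.carrier _).mkQ_surjective y
          rw [← map_add, upd, upd, upd, key, key, key, MultilinearMap.map_update_add, map_add]
        map_update_smul' := by
          intro _ b i c x
          obtain ⟨a, rfl⟩ := (I.carrier _).mkQ_surjective a
          choose b' hb' using fun i => (I.carrier (n i)).mkQ_surjective (b i)
          obtain rfl : (fun i => (I.carrier (n i)).mkQ (b' i)) = b := funext hb'
          obtain ⟨x, rfl⟩ := (I.carrier _).mkQ_surjective x
          rw [← map_smul, upd, upd, key, key, MultilinearMap.map_update_smul, map_smul] }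
    map_add' := by
      intro x y
      ext b
      obtain ⟨x, rfl⟩ := (I.carrier _).mkQ_surjective x
      obtain ⟨y, rfl⟩ := (I.carrier _).mkQ_surjective y
      choose b' hb' using fun i => (I.carrier (n i)).mkQ_surjective (b i)
      obtain rfl : (fun i => (I.carrier (n i)).mkQ (b' i)) = b := funext hb'
      simp only [MultilinearMap.coe_mk, add_apply]
      rw [← map_add (I.carrier m).mkQ, key, key, key, map_add (P.comp n),
        add_apply, map_add]
    map_smul' := by
      intro c x
      ext b
      obtain ⟨x, rfl⟩ := (I.carrier _).mkQ_surjective x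
      choose b' hb' using fun i => (I.carrier (n i)).mkQ_surjective (b i)
      obtain rfl : (fun i => (I.carrier (n i)).mkQ (b' i)) = b := funext hb'
      simp only [MultilinearMap.coe_mk, smul_apply, RingHom.id_apply]
      rw [← map_smul (I.carrier m).mkQ, key, key, map_smul (P.comp n),
        smul_apply, map_smul] }

theorem quotientComp_mk {m : ℕ} (n : Fin m → ℕ) (a : P.obj m) (b : ∀ i, P.obj (n i)) :
    (I.quotientComp n ((I.carrier m).mkQ a) fun i => (I.carrier (n i)).mkQ (b i)) =
      (I.carrier _).mkQ (P.comp n a b) :=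
  (Submodule.Quotient.eq _).2 (I.comp_sub_mem n
    ((Submodule.Quotient.eq _).1 (Quotient.out_eq _))
    fun _ => (Submodule.Quotient.eq _).1 (Quotient.out_eq _))

/-- The `S_n`-action on the quotient spaces `P(n) / I(n)`. -/
def quotientAct {m n : ℕ} (σ : Fin m ≃ Fin n) :
    (P.obj m ⧸ I.carrier m) →ₗ[K] (P.obj n ⧸ I.carrier n) :=
  (I.carrier m).mapQ (I.carrier n) (P.act σ) fun _ ha => I.act_mem σ ha

theorem quotientAct_mk {m n : ℕ} (σ : Fin m ≃ Fin n) (a : P.obj m) :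
    I.quotientAct σ ((I.carrier m).mkQ a) = (I.carrier n).mkQ (P.act σ a) := rfl

/-- The quotient operad `P / I`, with components `P(n) / I(n)`. -/
noncomputable def quotient : SymmOperad.{u, v} K where
  obj n := P.obj n ⧸ I.carrier n
  subsingleton_zero := by
    have := P.subsingleton_zero
    exact (I.carrier 0).mkQ_surjective.subsingleton
  act := I.quotientAct
  act_refl a := by
    obtain ⟨a, rfl⟩ := (I.carrier _).mkQ_surjective a
    rw [quotientAct_mk, P.act_refl]
  act_trans σ τ a := by
    obtain ⟨a, rfl⟩ := (I.carrier _).mkQ_surjective a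
    rw [quotientAct_mk, quotientAct_mk, quotientAct_mk, P.act_trans]
  one := (I.carrier 1).mkQ P.one
  comp := I.quotientComp
  one_comp a := by
    obtain ⟨a, rfl⟩ := (I.carrier _).mkQ_surjective a
    rw [quotientComp_mk, quotientAct_mk, P.one_comp]
  comp_one a := by
    obtain ⟨a, rfl⟩ := (I.carrier _).mkQ_surjective a
    rw [quotientComp_mk, quotientAct_mk, P.comp_one]
  assoc n q a b c := by
    obtain ⟨a, rfl⟩ := (I.carrier _).mkQ_surjective a
    choose b' hb' using fun i => (I.carrier (n i)).mkQ_surjective (b i)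
    obtain rfl : (fun i => (I.carrier (n i)).mkQ (b' i)) = b := funext hb'
    choose c' hc' using fun i j => (I.carrier (q i j)).mkQ_surjective (c i j)
    obtain rfl : (fun i j => (I.carrier (q i j)).mkQ (c' i j)) = c :=
      funext fun i => funext (hc' i)
    simp only [quotientComp_mk]
    rw [quotientAct_mk, P.assoc]
  comp_act_left σ n a b := by
    obtain ⟨a, rfl⟩ := (I.carrier _).mkQ_surjective a
    choose b' hb' using fun i => (I.carrier (n i)).mkQ_surjective (b i)
    obtain rfl : (fun i => (I.carrier (n i)).mkQ (b' i)) = b := funext hb'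
    rw [quotientAct_mk, quotientComp_mk, P.comp_act_left, ← quotientAct_mk, ← quotientComp_mk]
  comp_act_right τ a b := by
    obtain ⟨a, rfl⟩ := (I.carrier _).mkQ_surjective a
    choose b' hb' using fun i => (I.carrier _).mkQ_surjective (b i)
    obtain rfl : (fun i => (I.carrier _).mkQ (b' i)) = b := funext hb'
    simp only [quotientAct_mk]
    rw [quotientComp_mk, quotientComp_mk, P.comp_act_right, ← quotientAct_mk]

/-- The projection `P → P / I`. -/
noncomputable def quotientHom : Hom P I.quotient where
  app n := (I.carrier n).mkQ
  app_act _ _ := rfl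
  app_one := rfl
  app_comp n a b := (I.quotientComp_mk n a b).symm

end OperadIdeal
end SymmOperad

/-! ### The operad of nonassociative (magmatic) algebras -/

namespace Magmatic

section Free

variable {K : Type u} [Field K] {X : Type v} {Y : Type w}

/-- The multiset of letters of a nonassociative monomial. -/
def letters : FreeMagma X → Multiset X
  | .of x => {x}
  | .mul s t => letters s + letters t

/-- A nonassociative monomial, as an element of the free nonassociative algebra. -/
noncomputable def mon (K : Type u) [Field K] (t : FreeMagma X) :
    FreeNonUnitalNonAssocAlgebra K X :=
  MonoidAlgebra.single t 1

/-- The nonassociative polynomials all of whose monomials have the multiset of letters `S`. -/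
noncomputable def homogeneous (K : Type u) [Field K] (S : Multiset X) :
    Submodule K (FreeNonUnitalNonAssocAlgebra K X) :=
  Submodule.span K (mon K '' {t | letters t = S})

/-- Substitution of the polynomials `g x` for the variables `x`. -/
noncomputable def subst (g : X → FreeNonUnitalNonAssocAlgebra K Y) :
    FreeNonUnitalNonAssocAlgebra K X →ₙₐ[K] FreeNonUnitalNonAssocAlgebra K Y :=
  FreeNonUnitalNonAssocAlgebra.lift K g

/-- Renaming of the variables. -/
noncomputable def rename (K : Type u) [Field K] (e : X → Y) :
    FreeNonUnitalNonAssocAlgebra K X →ₙₐ[K] FreeNonUnitalNonAssocAlgebra K Y :=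
  subst fun x => FreeNonUnitalNonAssocAlgebra.of K (e x)

theorem mon_of (x : X) : mon K (FreeMagma.of x) = FreeNonUnitalNonAssocAlgebra.of K x := rfl

theorem mon_mul (s t : FreeMagma X) : mon K (s * t) = mon K s * mon K t := by
  simp [mon, MonoidAlgebra.single_mul_single]

theorem letters_of (x : X) : letters (FreeMagma.of x) = {x} := rfl

theorem letters_mul (s t : FreeMagma X) : letters (s * t) = letters s + letters t := rfl

theorem letters_ne_zero (t : FreeMagma X) : letters t ≠ 0 := by
  induction t with
  | ih1 x => simp [letters_of]
  | ih2 s t hs ht => simp [letters_mul, hs]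

theorem mon_mem (t : FreeMagma X) : mon K t ∈ homogeneous K (letters t) :=
  Submodule.subset_span ⟨t, rfl, rfl⟩

theorem mul_mem {S T : Multiset X} {f g : FreeNonUnitalNonAssocAlgebra K X}
    (hf : f ∈ homogeneous K S) (hg : g ∈ homogeneous K T) : f * g ∈ homogeneous K (S + T) := by
  induction hf using Submodule.span_induction with
  | zero => simp
  | add x y _ _ hx hy => rw [add_mul]; exact add_mem hx hy
  | smul a x _ hx => rw [smul_mul_assoc]; exact Submodule.smul_mem _ _ hx
  | mem x hx =>
    obtain ⟨s, hs, rfl⟩ := hx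
    induction hg using Submodule.span_induction with
    | zero => simp
    | add x y _ _ hx hy => rw [mul_add]; exact add_mem hx hy
    | smul a x _ hx => rw [mul_smul_comm]; exact Submodule.smul_mem _ _ hx
    | mem y hy =>
      obtain ⟨t, ht, rfl⟩ := hy
      rw [← mon_mul]
      refine Submodule.subset_span ⟨s * t, ?_, rfl⟩
      rw [Set.mem_ofPred_eq] at hs ht ⊢
      rw [letters_mul, hs, ht]

theorem subst_of (g : X → FreeNonUnitalNonAssocAlgebra K Y) (x : X) :
    subst g (FreeNonUnitalNonAssocAlgebra.of K x) = g x :=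
  FreeNonUnitalNonAssocAlgebra.lift_of_apply K g x

theorem subst_mon_mem {g : X → FreeNonUnitalNonAssocAlgebra K Y} {T : X → Multiset Y}
    (hg : ∀ x, g x ∈ homogeneous K (T x)) (t : FreeMagma X) :
    subst g (mon K t) ∈ homogeneous K ((letters t).bind T) := by
  induction t with
  | ih1 x => simpa [letters_of, mon_of, subst_of] using hg x
  | ih2 s t hs ht =>
    rw [mon_mul, map_mul, letters_mul, Multiset.add_bind]
    exact mul_mem hs ht

theorem subst_mem {g : X → FreeNonUnitalNonAssocAlgebra K Y} {T : X → Multiset Y}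
    (hg : ∀ x, g x ∈ homogeneous K (T x)) {S : Multiset X}
    {f : FreeNonUnitalNonAssocAlgebra K X} (hf : f ∈ homogeneous K S) :
    subst g f ∈ homogeneous K (S.bind T) := by
  induction hf using Submodule.span_induction with
  | zero => simp
  | add x y _ _ hx hy => rw [map_add]; exact add_mem hx hy
  | smul a x _ hx => rw [map_smul]; exact Submodule.smul_mem _ _ hx
  | mem x hx =>
    obtain ⟨s, rfl, rfl⟩ := hx
    exact subst_mon_mem hg s

theorem rename_mem (e : X → Y) {S : Multiset X} {f : FreeNonUnitalNonAssocAlgebra K X}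
    (hf : f ∈ homogeneous K S) : rename K e f ∈ homogeneous K (S.map e) := by
  rw [← Multiset.bind_singleton]
  exact subst_mem (fun x => by rw [← mon_of, ← letters_of]; exact mon_mem _) hf

theorem subst_rename {Z : Type*} (g : Y → FreeNonUnitalNonAssocAlgebra K Z) (e : X → Y)
    (f : FreeNonUnitalNonAssocAlgebra K X) : subst g (rename K e f) = subst (fun x => g (e x)) f := by
  have : (subst g).comp (rename K e) = subst fun x => g (e x) := by
    refine FreeNonUnitalNonAssocAlgebra.hom_ext K fun x => ?_
    simp [rename, subst_of]
  exact DFunLike.congr_fun this f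

theorem rename_rename {Z : Type*} (e' : Y → Z) (e : X → Y)
    (f : FreeNonUnitalNonAssocAlgebra K X) :
    rename K e' (rename K e f) = rename K (fun x => e' (e x)) f :=
  subst_rename _ _ _

theorem rename_subst {Z : Type*} (e : Y → Z) (g : X → FreeNonUnitalNonAssocAlgebra K Y)
    (f : FreeNonUnitalNonAssocAlgebra K X) :
    rename K e (subst g f) = subst (fun x => rename K e (g x)) f := by
  have : (rename K e).comp (subst g) = subst fun x => rename K e (g x) := by
    refine FreeNonUnitalNonAssocAlgebra.hom_ext K fun x => ?_
    simp [subst_of]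
  exact DFunLike.congr_fun this f

theorem subst_subst {Z : Type*} (h : Y → FreeNonUnitalNonAssocAlgebra K Z)
    (g : X → FreeNonUnitalNonAssocAlgebra K Y) (f : FreeNonUnitalNonAssocAlgebra K X) :
    subst h (subst g f) = subst (fun x => subst h (g x)) f := by
  have : (subst h).comp (subst g) = subst fun x => subst h (g x) := by
    refine FreeNonUnitalNonAssocAlgebra.hom_ext K fun x => ?_
    simp [subst_of]
  exact DFunLike.congr_fun this f

theorem rename_id (f : FreeNonUnitalNonAssocAlgebra K X) : rename K (fun x => x) f = f := by
  have : rename K (fun x : X => x) = NonUnitalAlgHom.id K _ := by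
    refine FreeNonUnitalNonAssocAlgebra.hom_ext K fun x => ?_
    simp [rename, subst_of]
  exact DFunLike.congr_fun this f

variable [DecidableEq X]

theorem subst_update_of_notMem (g : X → FreeNonUnitalNonAssocAlgebra K Y) (x : X)
    (p : FreeNonUnitalNonAssocAlgebra K Y) (t : FreeMagma X) (ht : x ∉ letters t) :
    subst (Function.update g x p) (mon K t) = subst g (mon K t) := by
  induction t with
  | ih1 y =>
    have : y ≠ x := by rintro rfl; simp [letters_of] at ht
    simp [mon_of, subst_of, this]
  | ih2 s t hs ht' =>
    simp only [letters_mul, Multiset.mem_add, not_or] at ht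
    rw [mon_mul, map_mul, map_mul, hs ht.1, ht' ht.2]

/-- A substitution is linear in the polynomial substituted for a letter that occurs once. -/
theorem subst_update_mon (g : X → FreeNonUnitalNonAssocAlgebra K Y) (x : X) (a b : K)
    (p q : FreeNonUnitalNonAssocAlgebra K Y) (t : FreeMagma X) (ht : (letters t).count x = 1) :
    subst (Function.update g x (a • p + b • q)) (mon K t) =
      a • subst (Function.update g x p) (mon K t) +
        b • subst (Function.update g x q) (mon K t) := by
  induction t with
  | ih1 y =>
    have : y = x := by
      by_contra h
      simp [letters_of, Ne.symm h] at ht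
    subst this
    simp [mon_of, subst_of]
  | ih2 s t hs ht' =>
    rw [letters_mul, Multiset.count_add] at ht
    simp only [mon_mul, map_mul]
    rcases Nat.add_eq_one_iff.1 ht with ⟨h0, h1⟩ | ⟨h1, h0⟩
    · have h0 := Multiset.count_eq_zero.1 h0
      rw [ht' h1]
      simp only [subst_update_of_notMem g x _ s h0, mul_add, mul_smul_comm]
    · have h0 := Multiset.count_eq_zero.1 h0
      rw [hs h1]
      simp only [subst_update_of_notMem g x _ t h0, add_mul, smul_mul_assoc]

theorem subst_update {S : Multiset X} {f : FreeNonUnitalNonAssocAlgebra K X}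
    (hf : f ∈ homogeneous K S) (g : X → FreeNonUnitalNonAssocAlgebra K Y) (x : X)
    (hx : S.count x = 1) (a b : K) (p q : FreeNonUnitalNonAssocAlgebra K Y) :
    subst (Function.update g x (a • p + b • q)) f =
      a • subst (Function.update g x p) f + b • subst (Function.update g x q) f := by
  induction hf using Submodule.span_induction with
  | zero => simp
  | add f f' _ _ hf hf' => simp only [map_add, hf, hf', smul_add]; abel
  | smul c f _ hf => simp only [map_smul, hf, smul_add, smul_comm c]
  | mem f hf =>
    obtain ⟨t, rfl, rfl⟩ := hf
    exact subst_update_mon g x a b p q t hx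

end Free

variable (K : Type u) [Field K]

/-- `Multilin K n`: the multilinear nonassociative polynomials in the variables
`x_0, …, x_{n - 1}`, i.e. the span of the monomials containing each variable exactly once. -/
noncomputable abbrev Multilin (n : ℕ) : Type u := homogeneous K (Finset.univ : Finset (Fin n)).val

variable {K}

/-- The permutation action, by renaming variables: `f ↦ f (x_{σ 0}, …, x_{σ (n - 1)})`. -/
noncomputable def act {m n : ℕ} (σ : Fin m ≃ Fin n) : Multilin K m →ₗ[K] Multilin K n where
  toFun f := ⟨rename K σ f.1, by
    have h := rename_mem σ f.2
    rwa [← Equiv.coe_toEmbedding, ← Finset.map_val, Finset.map_univ_equiv] at h⟩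
  map_add' f g := Subtype.ext (map_add _ _ _)
  map_smul' c f := Subtype.ext (map_smul _ _ _)

/-- The substitution of the polynomials `g 0, …, g (m - 1)`, in disjoint consecutive groups of
variables, for the variables. -/
noncomputable abbrev block {m : ℕ} {n : Fin m → ℕ} (g : ∀ i, Multilin K (n i)) (i : Fin m) :
    FreeNonUnitalNonAssocAlgebra K (Fin (∑ i, n i)) :=
  rename K (fun j => finSigmaFinEquiv ⟨i, j⟩) (g i).1

theorem subst_block_mem {m : ℕ} {n : Fin m → ℕ} (f : Multilin K m)
    (g : ∀ i, Multilin K (n i)) :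
    subst (block g) f.1 ∈ homogeneous K (Finset.univ : Finset (Fin (∑ i, n i))).val := by
  have h := subst_mem (fun i => rename_mem (fun j => finSigmaFinEquiv ⟨i, j⟩) (g i).2) f.2
  convert h using 2
  have e : (Finset.univ : Finset ((i : Fin m) × Fin (n i))).val =
      Multiset.sigma Finset.univ.val fun _ => Finset.univ.val := rfl
  rw [← Finset.map_univ_equiv finSigmaFinEquiv, Finset.map_val, e]
  simp only [Multiset.sigma, Multiset.map_bind, Multiset.map_map]
  rfl

theorem block_update {m : ℕ} {n : Fin m → ℕ} [DecidableEq (Fin m)] (g : ∀ i, Multilin K (n i))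
    (i : Fin m) (p : Multilin K (n i)) :
    block (Function.update g i p) =
      Function.update (block g) i (rename K (fun j => finSigmaFinEquiv ⟨i, j⟩) p.1) := by
  funext k
  exact Function.apply_update
    (fun k (p : Multilin K (n k)) => rename K (fun j => finSigmaFinEquiv ⟨k, j⟩) p.1) g i p k

/-- The composition: substitution of multilinear polynomials, in disjoint consecutive groups of
variables, into a multilinear polynomial. -/
noncomputable def comp {m : ℕ} (n : Fin m → ℕ) :
    Multilin K m →ₗ[K] MultilinearMap K (fun i => Multilin K (n i)) (Multilin K (∑ i, n i)) where
  toFun f :=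
    { toFun := fun g => ⟨subst (block g) f.1, subst_block_mem f g⟩
      map_update_add' := by
        intro _ g i p q
        refine Subtype.ext ?_
        have h := subst_update f.2 (block g) i (Multiset.count_univ i) 1 1
          (rename K (fun j => finSigmaFinEquiv ⟨i, j⟩) p.1)
          (rename K (fun j => finSigmaFinEquiv ⟨i, j⟩) q.1)
        simp only [one_smul] at h
        simp only [Submodule.coe_add, block_update, map_add]
        convert h
      map_update_smul' := by
        intro _ g i c p
        refine Subtype.ext ?_
        have h := subst_update f.2 (block g) i (Multiset.count_univ i) c 0
          (rename K (fun j => finSigmaFinEquiv ⟨i, j⟩) p.1) 0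
        simp only [zero_smul, add_zero] at h
        simp only [Submodule.coe_smul, block_update, map_smul]
        convert h }
  map_add' f f' := by
    refine MultilinearMap.ext fun g => Subtype.ext ?_
    exact (map_add (subst (block g)) f.1 f'.1)
  map_smul' c f := by
    refine MultilinearMap.ext fun g => Subtype.ext ?_
    exact (map_smul (subst (block g)) c f.1)

/-- The multilinear polynomial given by a monomial containing each variable exactly once. -/
noncomputable def ofMon {n : ℕ} (t : FreeMagma (Fin n))
    (ht : letters t = (Finset.univ : Finset (Fin n)).val) : Multilin K n :=
  ⟨mon K t, ht ▸ mon_mem t⟩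

end Magmatic

open Magmatic in
/-- The operad `Mag` of all nonassociative algebras with one bilinear operation, i.e. the free
operad on one binary operation without symmetry: `Mag(n)` consists of the multilinear
nonassociative polynomials in `n` variables, and the composition is substitution. -/
noncomputable def Mag (K : Type u) [Field K] : SymmOperad.{u, u} K where
  obj := Multilin K
  subsingleton_zero := by
    have h : homogeneous K (Finset.univ : Finset (Fin 0)).val = ⊥ := by
      rw [homogeneous, Submodule.span_eq_bot]
      rintro _ ⟨t, ht, rfl⟩
      exact absurd ht (letters_ne_zero t)
    exact (Submodule.subsingleton_iff_eq_bot).2 h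
  act := act
  act_refl a := Subtype.ext (rename_id a.1)
  act_trans σ τ a := Subtype.ext (rename_rename τ σ a.1).symm
  one := ofMon (FreeMagma.of 0) rfl
  comp := comp
  one_comp {n} a := by
    refine Subtype.ext ?_
    change rename K _ (subst _ (mon K _)) = _
    rw [mon_of, subst_of, rename_rename]
    convert rename_id a.1 with j
    ext
    simp [oneBlockEquiv]
  comp_one {m} a := by
    refine Subtype.ext ?_
    change rename K _ (subst _ _) = _
    rw [rename_subst]
    convert rename_id a.1 with j
    unfold rename
    congr 1
    funext j
    change rename K _ (rename K _ (mon K _)) = _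
    rw [rename_rename, mon_of, rename, subst_of]
    congr 1
    ext
    simp [unitBlocksEquiv]
  assoc n q a b c := by
    refine Subtype.ext ?_
    change rename K _ (subst _ (subst _ _)) = subst _ _
    rw [rename_subst, subst_subst]
    have key : ∀ k : Fin (∑ i, n i),
        rename K (graftAssocEquiv n q)
            (block (fun k => c (finSigmaFinEquiv.symm k).1 (finSigmaFinEquiv.symm k).2) k) =
          rename K (fun j => finSigmaFinEquiv ⟨(finSigmaFinEquiv.symm k).1, j⟩)
            (block (c (finSigmaFinEquiv.symm k).1) (finSigmaFinEquiv.symm k).2) := by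
      intro k
      rw [rename_rename, rename_rename]
      congr 2
      funext l
      simp [graftAssocEquiv, Equiv.sigmaCongrLeft, Equiv.sigmaAssoc]
    congr 2
    funext i
    change subst _ (rename K _ _) = rename K _ (subst _ _)
    rw [subst_rename, rename_subst]
    congr 2
    funext j
    rw [key, Equiv.symm_apply_apply]
  comp_act_left σ n a b := by
    refine Subtype.ext ?_
    change subst _ (rename K _ _) = rename K _ (subst _ _)
    rw [subst_rename, rename_subst]
    congr 2
    funext i
    rw [rename_rename]
    simp [blockEquiv]
  comp_act_right τ a b := by
    refine Subtype.ext ?_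
    change subst _ _ = rename K _ (subst _ _)
    rw [rename_subst]
    congr 2
    funext i
    rw [rename_rename]
    change rename K _ (rename K _ _) = _
    rw [rename_rename]
    simp [sumEquiv]

/-! ### The operads `Com`, `Lie` and `Lie-adm` -/

namespace SymmOperad

variable {K : Type u} [Field K] (P : SymmOperad.{u, v} K)

/-- `γ²_{k,l}(p; a, b)`, in arity `k + l`. -/
def comp₂ (p : P.obj 2) {k l : ℕ} (a : P.obj k) (b : P.obj l) : P.obj (k + l) :=
  P.act (finCongr (by simp)) <|
    P.comp ![k, l] p
      (Fin.cons (α := fun i => P.obj (![k, l] i)) a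
        (Fin.cons (α := fun i => P.obj (![k, l] (Fin.succ i))) b finZeroElim))

/-- `γ²_{2,1}(p; p, id)`, that is `(x₁ x₂) x₃`. -/
def leftNested (p : P.obj 2) : P.obj 3 := P.comp₂ p p P.one

/-- `γ²_{1,2}(p; id, p)`, that is `x₁ (x₂ x₃)`. -/
def rightNested (p : P.obj 2) : P.obj 3 := P.comp₂ p P.one p

/-- The operation `p` with its two arguments exchanged: `p^{(12)}`. -/
def opposite (p : P.obj 2) : P.obj 2 := P.act (Equiv.swap 0 1) p

/-- The Jacobi element `γ(p; p, 1) + γ(p; p, 1)^{(123)} + γ(p; p, 1)^{(132)}`. -/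
def jacobi (p : P.obj 2) : P.obj 3 :=
  P.leftNested p + P.act c[(0 : Fin 3), 1, 2] (P.leftNested p) +
    P.act c[(0 : Fin 3), 2, 1] (P.leftNested p)

/-- The Lie-admissibility element, that is (with letters `a b c` for the variables)
`(ab)c - (ba)c - c(ab) + c(ba) + (bc)a - (cb)a - a(bc) + a(cb) + (ca)b - (ac)b - b(ca) + b(ac)`. -/
def lieAdmissibility (p : P.obj 2) : P.obj 3 :=
  P.leftNested p
    - P.act (Equiv.swap (0 : Fin 3) 1) (P.leftNested p)
    - P.act c[(0 : Fin 3), 2, 1] (P.rightNested p)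
    + P.act (Equiv.swap (0 : Fin 3) 2) (P.rightNested p)
    + P.act c[(0 : Fin 3), 1, 2] (P.leftNested p)
    - P.act (Equiv.swap (0 : Fin 3) 2) (P.leftNested p)
    - P.rightNested p
    + P.act (Equiv.swap (1 : Fin 3) 2) (P.rightNested p)
    + P.act c[(0 : Fin 3), 2, 1] (P.leftNested p)
    - P.act (Equiv.swap (1 : Fin 3) 2) (P.leftNested p)
    - P.act c[(0 : Fin 3), 1, 2] (P.rightNested p)
    + P.act (Equiv.swap (0 : Fin 3) 1) (P.rightNested p)

end SymmOperad

open SymmOperad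

section Operads

variable (K : Type u) [Field K]

/-- The generating operation `x₁ x₂` of `Mag`. -/
noncomputable def magGen : (Mag K).obj 2 :=
  Magmatic.ofMon (FreeMagma.of 0 * FreeMagma.of 1) (by decide)

/-- The ideal of `Mag` generated by `x₂ x₁ - x₁ x₂`. -/
noncomputable def comIdeal : (Mag K).OperadIdeal :=
  (Mag K).idealSpan {⟨2, (Mag K).opposite (magGen K) - magGen K⟩}

/-- The operad `Com` of commutative (not necessarily associative) algebras. -/
noncomputable def Com : SymmOperad.{u, u} K := (comIdeal K).quotient

/-- The generating (commutative) operation of `Com`. -/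
noncomputable def comGen : (Com K).obj 2 := (comIdeal K).quotientHom.app 2 (magGen K)

/-- The ideal of `Mag` generated by `x₂ x₁ + x₁ x₂` and the Jacobi identity. -/
noncomputable def lieIdeal : (Mag K).OperadIdeal :=
  (Mag K).idealSpan
    {⟨2, (Mag K).opposite (magGen K) + magGen K⟩, ⟨3, (Mag K).jacobi (magGen K)⟩}

/-- The operad `Lie` of Lie algebras (over a field of characteristic not `2`). -/
noncomputable def Lie : SymmOperad.{u, u} K := (lieIdeal K).quotient

/-- The generating operation of `Lie`, the bracket. -/
noncomputable def lieGen : (Lie K).obj 2 := (lieIdeal K).quotientHom.app 2 (magGen K)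

/-- The ideal of `Mag` generated by the Lie-admissibility identity. -/
noncomputable def lieAdmIdeal : (Mag K).OperadIdeal :=
  (Mag K).idealSpan {⟨3, (Mag K).lieAdmissibility (magGen K)⟩}

/-- The operad `Lie-adm` of Lie-admissible algebras. -/
noncomputable def LieAdm : SymmOperad.{u, u} K := (lieAdmIdeal K).quotient

/-- The generating operation `x = x₁ x₂` of `Lie-adm`; the other basis element of `Lie-adm(2)`
is `y = x₂ x₁`, its opposite. -/
noncomputable def lieAdmGen : (LieAdm K).obj 2 := (lieAdmIdeal K).quotientHom.app 2 (magGen K)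

end Operads

/-! ### Labelled operations -/

/-! Everything rests on polarization. Since 2 is invertible, a binary operation `p` with opposite
`q` carries the same information as the pair consisting of the skew operation `m = p - q` and the
symmetric operation `c = p + q`, with inverse `p = (m + c)/2`. The Lie-admissibility element of `p`
is exactly the Jacobi element of `p - q` (`jacobi_sub_opposite`). A morphism from `Lie-adm` to `P`
is an operation in `P(2)` killing that element. It therefore amounts to a skew operation satisfying
Jacobi together with an arbitrary symmetric one, that is, to a morphism from `Lie` and a morphism
from `Com`. This is the universal property of the free product (`isFreeProduct_lieAdm`), and
uniqueness up to isomorphism is formal.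

The bulk of the work is to show that the concrete `Mag`, made of multilinear nonassociative
polynomials, is free on one binary operation (`magLift`, `Hom.mag_ext`). A monomial must be
evaluated at `p` by iterated composition, where nested sums of arities and block permutations get in
the way. Labelled operations, taken up to renumbering of the inputs, absorb these permutations: each
operad axiom becomes an equivalence of grafts, and evaluation commutes with substitution by
induction on monomials (`ofMonomial_lift`). When the labels are bijective, `toOp` recovers an honest
operation. The quotients of `Mag` then inherit their universal properties through kernels. -/

theorem sumEquiv_apply {m : ℕ} {n n' : Fin m → ℕ} (τ : ∀ i, Fin (n i) ≃ Fin (n' i)) (i : Fin m)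
    (j : Fin (n i)) :
    sumEquiv τ (finSigmaFinEquiv ⟨i, j⟩) = finSigmaFinEquiv ⟨i, τ i j⟩ := by
  simp [sumEquiv]

theorem blockEquiv_apply {m m' : ℕ} (σ : Fin m ≃ Fin m') (n : Fin m' → ℕ) (i : Fin m)
    (j : Fin (n (σ i))) :
    blockEquiv σ n (finSigmaFinEquiv (n := fun i => n (σ i)) ⟨i, j⟩) =
      finSigmaFinEquiv ⟨σ i, j⟩ := by
  simp [blockEquiv, Equiv.sigmaCongrLeft]

theorem graftAssocEquiv_apply {m : ℕ} (n : Fin m → ℕ) (q : ∀ i, Fin (n i) → ℕ)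
    (k : Fin (∑ i, n i))
    (l : Fin (q (finSigmaFinEquiv.symm k).1 (finSigmaFinEquiv.symm k).2)) :
    graftAssocEquiv n q (finSigmaFinEquiv
        (n := fun k => q (finSigmaFinEquiv.symm k).1 (finSigmaFinEquiv.symm k).2) ⟨k, l⟩) =
      finSigmaFinEquiv ⟨(finSigmaFinEquiv.symm k).1,
        finSigmaFinEquiv ⟨(finSigmaFinEquiv.symm k).2, l⟩⟩ := by
  simp [graftAssocEquiv, Equiv.sigmaCongrLeft, Equiv.sigmaAssoc]

theorem oneBlockEquiv_apply {n : ℕ} (i : Fin 1) (j : Fin n) :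
    oneBlockEquiv n (finSigmaFinEquiv (n := fun _ => n) ⟨i, j⟩) = j := by
  ext
  simp [oneBlockEquiv]

theorem unitBlocksEquiv_apply {m : ℕ} (i : Fin m) (j : Fin 1) :
    unitBlocksEquiv m (finSigmaFinEquiv (n := fun _ => 1) ⟨i, j⟩) = i := by
  ext
  simp [unitBlocksEquiv]

namespace SymmOperad

variable {K : Type u} [Field K]

/-- An operation of an operad whose inputs are labelled by elements of `X`, possibly with
repetitions. -/
structure Labelled (P : SymmOperad.{u, v} K) (X : Type w) where
  arity : ℕ
  op : P.obj arity
  label : Fin arity → X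

namespace Labelled

variable {P : SymmOperad.{u, v} K} {X Y : Type*}

/-- Two labelled operations are equivalent if they differ by a renumbering of the inputs. -/
def Equivalent (x y : Labelled P X) : Prop :=
  ∃ σ : Fin x.arity ≃ Fin y.arity, P.act σ x.op = y.op ∧ ∀ i, y.label (σ i) = x.label i

theorem Equivalent.refl (x : Labelled P X) : x.Equivalent x :=
  ⟨Equiv.refl _, P.act_refl _, fun _ => rfl⟩

theorem Equivalent.symm {x y : Labelled P X} (h : x.Equivalent y) : y.Equivalent x := by
  obtain ⟨σ, h1, h2⟩ := h
  refine ⟨σ.symm, ?_, fun i => by rw [← h2, σ.apply_symm_apply]⟩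
  rw [← h1, ← P.act_trans, σ.self_trans_symm, P.act_refl]

theorem Equivalent.trans {x y z : Labelled P X} (h : x.Equivalent y) (h' : y.Equivalent z) :
    x.Equivalent z := by
  obtain ⟨σ, h1, h2⟩ := h
  obtain ⟨τ, h3, h4⟩ := h'
  exact ⟨σ.trans τ, by rw [P.act_trans, h1, h3], fun i => by rw [Equiv.trans_apply, h4, h2]⟩

/-- Composition with labelled operations. -/
def graft {m : ℕ} (a : P.obj m) (x : Fin m → Labelled P X) : Labelled P X where
  arity := ∑ i, (x i).arity
  op := P.comp _ a fun i => (x i).op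
  label k := (x (finSigmaFinEquiv.symm k).1).label (finSigmaFinEquiv.symm k).2

theorem graft_label {m : ℕ} (a : P.obj m) (x : Fin m → Labelled P X) (i : Fin m)
    (j : Fin (x i).arity) : (graft a x).label (finSigmaFinEquiv ⟨i, j⟩) = (x i).label j := by
  change (x (finSigmaFinEquiv.symm (finSigmaFinEquiv _)).1).label _ = _
  rw [Equiv.symm_apply_apply]

/-- Equivariance in the inner arguments: the renumberings of the grafted operations combine into the
block sum `sumEquiv`. -/
theorem graft_congr {m : ℕ} (a : P.obj m) {x y : Fin m → Labelled P X}
    (h : ∀ i, (x i).Equivalent (y i)) : (graft a x).Equivalent (graft a y) := by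
  choose σ h1 h2 using h
  refine ⟨sumEquiv σ, ?_, fun k => ?_⟩
  · simp only [graft, ← h1]
    exact (P.comp_act_right σ a _).symm
  · obtain ⟨⟨i, j⟩, rfl⟩ := finSigmaFinEquiv.surjective k
    refine (congrArg (graft a y).label (sumEquiv_apply σ i j)).trans ?_
    rw [graft_label, graft_label, h2]

/-- Equivariance in the outer argument, with the block permutation hidden in the equivalence. -/
theorem graft_act {m m' : ℕ} (σ : Fin m ≃ Fin m') (a : P.obj m) (x : Fin m' → Labelled P X) :
    (graft a fun i => x (σ i)).Equivalent (graft (P.act σ a) x) := by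
  refine ⟨blockEquiv σ fun i => (x i).arity, ?_, fun k => ?_⟩
  · exact (P.comp_act_left σ (fun i => (x i).arity) a fun i => (x i).op).symm
  · obtain ⟨⟨i, j⟩, rfl⟩ := finSigmaFinEquiv.surjective k
    refine (congrArg (graft (P.act σ a) x).label (blockEquiv_apply σ _ i j)).trans ?_
    rw [graft_label, graft_label]

/-- The associativity axiom, freed of the reindexing `graftAssocEquiv`. -/
theorem graft_graft {m : ℕ} (n : Fin m → ℕ) (a : P.obj m) (b : ∀ i, P.obj (n i))
    (x : ∀ i, Fin (n i) → Labelled P X) :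
    (graft (P.comp n a b)
        fun k => x (finSigmaFinEquiv.symm k).1 (finSigmaFinEquiv.symm k).2).Equivalent
      (graft a fun i => graft (b i) (x i)) := by
  refine ⟨graftAssocEquiv n fun i j => (x i j).arity, ?_, fun k => ?_⟩
  · exact P.assoc n (fun i j => (x i j).arity) a b fun i j => (x i j).op
  · obtain ⟨⟨i, j⟩, rfl⟩ := finSigmaFinEquiv.surjective k
    refine (congrArg (graft a fun i => graft (b i) (x i)).label
      (graftAssocEquiv_apply n (fun i j => (x i j).arity) i j)).trans ?_
    refine (graft_label a (fun i => graft (b i) (x i)) _ _).trans ?_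
    rw [graft_label, graft_label]

theorem graft_one (x : Fin 1 → Labelled P X) : (graft P.one x).Equivalent (x 0) := by
  -- The axiom `one_comp` is stated for a constant family of arities, so the family is first made
  -- literally constant.
  obtain ⟨y, rfl⟩ : ∃ y, x = fun _ => y := ⟨x 0, funext fun i => by rw [Subsingleton.elim i 0]⟩
  refine ⟨oneBlockEquiv y.arity, P.one_comp y.op, fun k => ?_⟩
  obtain ⟨⟨i, j⟩, rfl⟩ := finSigmaFinEquiv.surjective k
  rw [graft_label]
  exact congrArg y.label (oneBlockEquiv_apply i j)

/-- The identity operation, with its input labelled by `x`. -/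
def unit (P : SymmOperad.{u, v} K) (x : X) : Labelled P X := ⟨1, P.one, fun _ => x⟩

theorem graft_unit {m : ℕ} (a : P.obj m) (l : Fin m → X) :
    (graft a fun i => unit P (l i)).Equivalent ⟨m, a, l⟩ := by
  refine ⟨unitBlocksEquiv m, P.comp_one a, fun k => ?_⟩
  obtain ⟨⟨i, j⟩, rfl⟩ := finSigmaFinEquiv.surjective k
  rw [graft_label]
  exact congrArg l (unitBlocksEquiv_apply i j)

/-- Change of labels. -/
def relabel (f : X → Y) (x : Labelled P X) : Labelled P Y := ⟨x.arity, x.op, fun i => f (x.label i)⟩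

theorem Equivalent.relabel {x y : Labelled P X} (h : x.Equivalent y) (f : X → Y) :
    (x.relabel f).Equivalent (y.relabel f) := by
  obtain ⟨σ, h1, h2⟩ := h
  exact ⟨σ, h1, fun i => congrArg f (h2 i)⟩

/-- Substitution of labelled operations for the labels. -/
def bind (x : Labelled P X) (s : X → Labelled P Y) : Labelled P Y :=
  graft x.op fun i => s (x.label i)

theorem Equivalent.bind {x y : Labelled P X} (h : x.Equivalent y) {s s' : X → Labelled P Y}
    (hs : ∀ i, (s i).Equivalent (s' i)) : (x.bind s).Equivalent (y.bind s') := by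
  obtain ⟨σ, h1, h2⟩ := h
  refine Equivalent.trans ?_ (graft_congr y.op fun i => hs _)
  have h := graft_act σ x.op fun i => s (y.label i)
  simp only [h1, h2] at h
  exact h

theorem bind_graft {m : ℕ} (a : P.obj m) (x : Fin m → Labelled P X) (s : X → Labelled P Y) :
    ((graft a x).bind s).Equivalent (graft a fun i => (x i).bind s) :=
  graft_graft (fun i => (x i).arity) a (fun i => (x i).op) fun i j => s ((x i).label j)

/-- The labelled operation obtained from a nonassociative monomial by evaluating the
multiplication as the binary operation `p`. -/
def ofMonomial (p : P.obj 2) : FreeMagma X → Labelled P X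
  | .of x => unit P x
  | .mul s t => graft p ![ofMonomial p s, ofMonomial p t]

theorem ofMonomial_mul (p : P.obj 2) (s t : FreeMagma X) :
    ofMonomial p (s * t) = graft p ![ofMonomial p s, ofMonomial p t] := rfl

/-- Induction on the monomial: a letter is the left unit law, and a product is associativity of
grafting. This is the source of compatibility of evaluation with both composition and renaming. -/
theorem ofMonomial_lift (p : P.obj 2) (t : FreeMagma X) (s : X → FreeMagma Y) :
    (ofMonomial p (FreeMagma.lift s t)).Equivalent
      ((ofMonomial p t).bind fun x => ofMonomial p (s x)) := by
  induction t with
  | ih1 x => exact (graft_one fun _ => ofMonomial p (s x)).symm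
  | ih2 t₁ t₂ h₁ h₂ =>
    rw [map_mul, ofMonomial_mul, ofMonomial_mul]
    refine Equivalent.trans (graft_congr p fun i => ?_) (bind_graft _ _ _).symm
    fin_cases i
    exacts [h₁, h₂]

theorem ofMonomial_map (p : P.obj 2) (t : FreeMagma X) (f : X → Y) :
    (ofMonomial p (FreeMagma.lift (fun x => FreeMagma.of (f x)) t)).Equivalent
      ((ofMonomial p t).relabel f) :=
  (ofMonomial_lift p t _).trans (graft_unit _ _)

theorem letters_eq (p : P.obj 2) (t : FreeMagma X) :
    Magmatic.letters t = ∑ i, {(ofMonomial p t).label i} := by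
  induction t with
  | ih1 x => exact (Finset.sum_singleton (fun _ : Fin 1 => ({x} : Multiset X)) 0).symm
  | ih2 t₁ t₂ h₁ h₂ =>
    rw [Magmatic.letters_mul, ofMonomial_mul]
    have h : ∑ k, ({(graft p ![ofMonomial p t₁, ofMonomial p t₂]).label k} : Multiset X) =
        ∑ k : (i : Fin 2) × Fin (![ofMonomial p t₁, ofMonomial p t₂] i).arity,
          {(![ofMonomial p t₁, ofMonomial p t₂] k.1).label k.2} :=
      Fintype.sum_equiv finSigmaFinEquiv.symm _ _ fun _ => rfl
    rw [h, Fintype.sum_sigma, Fin.sum_univ_two, h₁, h₂]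
    rfl

/-- The labels, counted with multiplicity, are the letters of the monomial. That multiset being
duplicate-free gives injectivity, and its containing every index gives surjectivity. -/
theorem ofMonomial_bijective (p : P.obj 2) {n : ℕ} {t : FreeMagma (Fin n)}
    (ht : Magmatic.letters t = (Finset.univ : Finset (Fin n)).val) :
    Function.Bijective (ofMonomial p t).label := by
  have h : Finset.univ.val.map (ofMonomial p t).label = Finset.univ.val := by
    rw [← ht, letters_eq p]
    refine (Multiset.sum_map_singleton _).symm.trans ?_
    rw [Multiset.map_map]
    rfl
  refine ⟨fun i j hij => ?_, fun k => ?_⟩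
  · exact Multiset.inj_on_of_nodup_map (h ▸ Finset.univ.nodup) i (Finset.mem_univ_val i) j
      (Finset.mem_univ_val j) hij
  · have hk : k ∈ Finset.univ.val.map (ofMonomial p t).label := h ▸ Finset.mem_univ_val k
    obtain ⟨i, -, hi⟩ := Multiset.mem_map.1 hk
    exact ⟨i, hi⟩

open Classical in
/-- The operation of arity `n` given by an operation whose inputs are labelled bijectively by
`0, …, n - 1` (and `0` if they are not). -/
noncomputable def toOp {n : ℕ} (x : Labelled P (Fin n)) : P.obj n :=
  if h : Function.Bijective x.label then P.act (Equiv.ofBijective x.label h) x.op else 0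

/-- When the target carries the identity labelling, the renumbering is forced to be the label map
itself, so the operation can be read off from the equivalence class. -/
theorem toOp_eq {n : ℕ} {x : Labelled P (Fin n)} {a : P.obj n}
    (h : x.Equivalent ⟨n, a, fun i => i⟩) : x.toOp = a := by
  obtain ⟨σ, h1, h2⟩ := h
  have hb : Function.Bijective x.label := funext h2 ▸ σ.bijective
  have e : Equiv.ofBijective x.label hb = σ := Equiv.ext fun i => (h2 i).symm
  rw [toOp, dif_pos hb, e]
  exact h1

theorem equivalent_toOp {n : ℕ} {x : Labelled P (Fin n)} (h : Function.Bijective x.label) :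
    x.Equivalent ⟨n, x.toOp, fun i => i⟩ :=
  ⟨Equiv.ofBijective x.label h, by rw [toOp, dif_pos h], fun _ => rfl⟩

end Labelled
end SymmOperad

/-! ### The universal property of `Mag` -/

/-- Multilinear maps that agree on spanning sets are equal. -/
theorem MultilinearMap.ext_of_span {R ι : Type*} [Fintype ι] [CommSemiring R] {M : ι → Type*}
    {N : Type*} [∀ i, AddCommMonoid (M i)] [∀ i, Module R (M i)] [AddCommMonoid N] [Module R N]
    {f g : MultilinearMap R M N} {S : ∀ i, Set (M i)} (hS : ∀ i, Submodule.span R (S i) = ⊤)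
    (h : ∀ m : ∀ i, M i, (∀ i, m i ∈ S i) → f m = g m) : f = g := by
  classical
  -- Here `s` is the set of slots where the argument is unrestricted. Slots are freed one at a time,
  -- using linearity in the new slot.
  have key : ∀ (s : Finset ι) (m : ∀ i, M i), (∀ i ∉ s, m i ∈ S i) → f m = g m := by
    intro s
    induction s using Finset.induction_on with
    | empty => exact fun m hm => h m fun i => hm i (Finset.notMem_empty i)
    | insert i s _ ih =>
      intro m hm
      have e : f.toLinearMap m i = g.toLinearMap m i := by
        refine LinearMap.ext_on (hS i) fun x hx => ih _ fun j hj => ?_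
        rcases eq_or_ne j i with rfl | hji
        · simpa using hx
        · simpa [hji] using hm j (by simp [hj, hji])
      simpa using LinearMap.congr_fun e (m i)
  exact MultilinearMap.ext fun m => key Finset.univ m fun i hi => absurd (Finset.mem_univ i) hi

namespace Magmatic

variable {K : Type u} [Field K] {X Y : Type*}

theorem subst_mon (s : X → FreeMagma Y) (t : FreeMagma X) :
    subst (fun x => mon K (s x)) (mon K t) = mon K (FreeMagma.lift s t) := by
  induction t with
  | ih1 x => exact subst_of _ x
  | ih2 t₁ t₂ h₁ h₂ => rw [mon_mul, map_mul, h₁, h₂, map_mul, mon_mul]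

theorem rename_mon (e : X → Y) (t : FreeMagma X) :
    rename K e (mon K t) = mon K (FreeMagma.lift (fun x => FreeMagma.of (e x)) t) :=
  subst_mon _ t

theorem multilin_induction {n : ℕ} {p : Multilin K n → Prop}
    (mon : ∀ t ht, p (ofMon t ht)) (zero : p 0) (add : ∀ f g, p f → p g → p (f + g))
    (smul : ∀ (c : K) f, p f → p (c • f)) (f : Multilin K n) : p f := by
  obtain ⟨f, hf⟩ := f
  induction hf using Submodule.span_induction with
  | zero => exact zero
  | add x y hx hy h₁ h₂ => exact add ⟨x, hx⟩ ⟨y, hy⟩ h₁ h₂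
  | smul c x hx h => exact smul c ⟨x, hx⟩ h
  | mem x hx =>
    obtain ⟨t, ht, rfl⟩ := hx
    exact mon t ht

theorem span_ofMon (n : ℕ) :
    Submodule.span K {f : Multilin K n | ∃ t ht, f = ofMon t ht} = ⊤ := by
  refine Submodule.eq_top_iff'.2 fun f => ?_
  induction f using multilin_induction with
  | mon t ht => exact Submodule.subset_span ⟨t, ht, rfl⟩
  | zero => exact zero_mem _
  | add f g hf hg => exact add_mem hf hg
  | smul c f hf => exact Submodule.smul_mem _ c hf

end Magmatic

namespace SymmOperad

open Labelled Magmatic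

variable {K : Type u} [Field K] {P : SymmOperad.{u, v} K}

/-! ### Symmetric group action and composition through `toOp` -/

namespace Labelled

theorem toOp_relabel {m n : ℕ} (σ : Fin m ≃ Fin n) {x : Labelled P (Fin m)}
    (h : Function.Bijective x.label) : (x.relabel σ).toOp = P.act σ x.toOp :=
  toOp_eq (((equivalent_toOp h).relabel σ).trans ⟨σ, rfl, fun _ => rfl⟩)

/-- Relabelling the `i`-th operation by the positions of block `i` mirrors what `Magmatic.block`
does to variables, so this is the operadic counterpart of composition in `Mag`. -/
theorem bind_relabel_equivalent {m : ℕ} {n : Fin m → ℕ} {x : Labelled P (Fin m)}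
    {y : ∀ i, Labelled P (Fin (n i))} (hx : Function.Bijective x.label)
    (hy : ∀ i, Function.Bijective (y i).label) :
    (x.bind fun i => (y i).relabel fun j => finSigmaFinEquiv ⟨i, j⟩).Equivalent
      ⟨∑ i, n i, P.comp n x.toOp fun i => (y i).toOp, fun i => i⟩ := by
  refine ((equivalent_toOp hx).bind fun i => (equivalent_toOp (hy i)).relabel _).trans
    ⟨Equiv.refl _, P.act_refl _, fun k => ?_⟩
  exact (finSigmaFinEquiv.apply_symm_apply k).symm

theorem toOp_congr {n : ℕ} {x y : Labelled P (Fin n)} (h : x.Equivalent y)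
    (hy : Function.Bijective y.label) : x.toOp = y.toOp :=
  toOp_eq (h.trans (equivalent_toOp hy))

end Labelled

/-- The evaluation at a binary operation of nonassociative polynomials, disregarding the monomials
that are not multilinear. -/
noncomputable def polynomialEval (p : P.obj 2) (n : ℕ) :
    FreeNonUnitalNonAssocAlgebra K (Fin n) →ₗ[K] P.obj n :=
  -- All monomials form a basis of the free algebra, so values may be prescribed freely on them. The
  -- junk values on non-multilinear monomials disappear on restriction to multilinear polynomials.
  (Finsupp.linearCombination K fun t => (ofMonomial p t).toOp) ∘ₗ
    (MonoidAlgebra.coeffLinearEquiv K).toLinearMap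

theorem polynomialEval_mon (p : P.obj 2) {n : ℕ} (t : FreeMagma (Fin n)) :
    polynomialEval p n (mon K t) = (ofMonomial p t).toOp := by
  change Finsupp.linearCombination K _ (Finsupp.single t 1) = _
  rw [Finsupp.linearCombination_single, one_smul]

/-- The evaluation of multilinear nonassociative polynomials at a binary operation. -/
noncomputable def magEval (p : P.obj 2) (n : ℕ) : Multilin K n →ₗ[K] P.obj n :=
  polynomialEval p n ∘ₗ (homogeneous K _).subtype

theorem magEval_ofMon (p : P.obj 2) {n : ℕ} (t : FreeMagma (Fin n))
    (ht : letters t = (Finset.univ : Finset (Fin n)).val) :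
    magEval p n (ofMon t ht) = (ofMonomial p t).toOp :=
  polynomialEval_mon p t

theorem magEval_act (p : P.obj 2) {m n : ℕ} (σ : Fin m ≃ Fin n) (a : Multilin K m) :
    magEval p n (Magmatic.act σ a) = P.act σ (magEval p m a) := by
  suffices h : (magEval p n).comp (Magmatic.act σ) = (P.act σ).comp (magEval p m) from
    LinearMap.congr_fun h a
  refine LinearMap.ext_on (span_ofMon m) ?_
  rintro _ ⟨t, ht, rfl⟩
  have e : magEval p n (Magmatic.act σ (ofMon t ht)) =
      (ofMonomial p (FreeMagma.lift (fun i => FreeMagma.of (σ i)) t)).toOp :=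
    (congrArg (polynomialEval p n) (rename_mon _ _)).trans (polynomialEval_mon p _)
  rw [LinearMap.comp_apply, LinearMap.comp_apply, e, magEval_ofMon,
    ← toOp_relabel σ (ofMonomial_bijective p ht)]
  exact toOp_congr (ofMonomial_map _ _ _) (σ.bijective.comp (ofMonomial_bijective p ht))

/-- By multilinearity it suffices to compose monomials. There composition is substitution of
monomials, and `ofMonomial_lift` applies. -/
theorem magEval_comp (p : P.obj 2) {m : ℕ} (n : Fin m → ℕ) (a : Multilin K m)
    (b : ∀ i, Multilin K (n i)) :
    magEval p (∑ i, n i) (Magmatic.comp n a b) =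
      P.comp n (magEval p m a) fun i => magEval p (n i) (b i) := by
  -- Both sides are packaged as linear maps in `a` with values in multilinear maps in `b`, so that
  -- each variable can be tested on a spanning set.
  suffices h : (LinearMap.compMultilinearMapₗ K (magEval p (∑ i, n i))).comp (Magmatic.comp n) =
      (MultilinearMap.compLinearMapₗ fun i => magEval p (n i)).comp
        ((P.comp n).comp (magEval p m)) from
    MultilinearMap.congr_fun (LinearMap.congr_fun h a) b
  refine LinearMap.ext_on (span_ofMon m) ?_
  rintro _ ⟨t, ht, rfl⟩
  refine MultilinearMap.ext_of_span (fun i => span_ofMon (n i)) fun b hb => ?_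
  choose s hs hb using hb
  obtain rfl : b = fun i => ofMon (s i) (hs i) := funext hb
  change polynomialEval p _ (subst (fun i => rename K _ (mon K (s i))) (mon K t)) =
    P.comp n (magEval p m (ofMon t ht)) fun i => magEval p (n i) (ofMon (s i) (hs i))
  simp only [rename_mon, subst_mon, polynomialEval_mon, magEval_ofMon]
  refine toOp_eq (((ofMonomial_lift p t _).trans
    ((Equivalent.refl _).bind fun i => ofMonomial_map p (s i) _)).trans ?_)
  exact bind_relabel_equivalent (ofMonomial_bijective p ht) fun i => ofMonomial_bijective p (hs i)

/-- The morphism from `Mag` given by a binary operation. -/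
noncomputable def magLift (p : P.obj 2) : Hom (Mag K) P where
  app := magEval p
  app_act := magEval_act p
  app_one := by
    refine (magEval_ofMon p (FreeMagma.of 0) rfl).trans (toOp_eq ?_)
    exact ⟨Equiv.refl _, P.act_refl _, fun i => Subsingleton.elim (α := Fin 1) _ _⟩
  app_comp := magEval_comp p

theorem magLift_gen (p : P.obj 2) : (magLift p).app 2 (magGen K) = p := by
  refine (magEval_ofMon _ _ _).trans (toOp_eq ?_)
  change (graft p ![unit P 0, unit P 1]).Equivalent _
  convert graft_unit p fun i => i using 2
  funext i
  fin_cases i <;> rfl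

/-- The polynomial given by a polynomial whose variables are labelled by variables. -/
noncomputable def Labelled.toPolynomial {X : Type*} (x : Labelled (Mag K) X) :
    FreeNonUnitalNonAssocAlgebra K X :=
  rename K x.label (show Multilin K _ from x.op).1

theorem Labelled.toPolynomial_graft {X : Type*} {m : ℕ} (a : (Mag K).obj m)
    (x : Fin m → Labelled (Mag K) X) : (graft a x).toPolynomial =
      subst (fun i => (x i).toPolynomial) (show Multilin K _ from a).1 := by
  refine (rename_subst _ _ _).trans (congrArg (fun g => subst g _) (funext fun i => ?_))
  refine (rename_rename _ _ _).trans (congrArg (fun l => rename K l _) (funext fun j => ?_))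
  exact graft_label a x i j

theorem Labelled.toPolynomial_ofMonomial {X : Type*} (t : FreeMagma X) :
    (ofMonomial (magGen K) t).toPolynomial = mon K t := by
  induction t with
  | ih1 x => exact subst_of _ _
  | ih2 s t hs ht =>
    rw [ofMonomial_mul, toPolynomial_graft, mon_mul, ← hs, ← ht]
    change subst _ (mon K (FreeMagma.of 0 * FreeMagma.of 1)) = _
    rw [mon_mul, map_mul, mon_of, mon_of, subst_of, subst_of]
    rfl

/-- Every multilinear monomial arises from the generator by compositions and a permutation; in other
words, `magGen` generates `Mag`. Uniqueness of morphisms from `Mag` follows. -/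
theorem toOp_ofMonomial_magGen {n : ℕ} (t : FreeMagma (Fin n))
    (ht : letters t = (Finset.univ : Finset (Fin n)).val) :
    (ofMonomial (magGen K) t).toOp = (ofMon t ht : Multilin K n) := by
  refine Subtype.ext (Eq.trans ?_ (toPolynomial_ofMonomial t))
  rw [toOp, dif_pos (ofMonomial_bijective _ ht)]
  rfl

/-! ### Uniqueness of morphisms from `Mag` -/

namespace Hom

variable {Q : SymmOperad.{u, w} K}

/-- The image of a labelled operation under a morphism. -/
def mapLabelled (φ : Hom P Q) {X : Type*} (x : Labelled P X) : Labelled Q X :=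
  ⟨x.arity, φ.app _ x.op, x.label⟩

theorem mapLabelled_graft (φ : Hom P Q) {X : Type*} {m : ℕ} (a : P.obj m)
    (x : Fin m → Labelled P X) :
    φ.mapLabelled (graft a x) = graft (φ.app m a) fun i => φ.mapLabelled (x i) :=
  congrArg (fun b => Labelled.mk _ b _) (φ.app_comp _ a _)

theorem mapLabelled_ofMonomial (φ : Hom P Q) {X : Type*} (p : P.obj 2) (t : FreeMagma X) :
    φ.mapLabelled (ofMonomial p t) = ofMonomial (φ.app 2 p) t := by
  induction t with
  | ih1 x => exact congrArg (fun a => Labelled.mk 1 a fun _ => x) φ.app_one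
  | ih2 s t hs ht =>
    rw [ofMonomial_mul, ofMonomial_mul, ← hs, ← ht, mapLabelled_graft]
    congr 1
    funext i
    fin_cases i <;> rfl

/-- No bijectivity is needed, because the default value 0 of `toOp` is preserved by linear maps. -/
theorem toOp_mapLabelled (φ : Hom P Q) {n : ℕ} (x : Labelled P (Fin n)) :
    (φ.mapLabelled x).toOp = φ.app n x.toOp := by
  by_cases h : Function.Bijective x.label
  · rw [toOp, dif_pos (by exact h), toOp, dif_pos h, φ.app_act]
    rfl
  · rw [toOp, dif_neg (by exact h), toOp, dif_neg h, map_zero]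

/-- A morphism from `Mag` is determined by the image of the generator. -/
theorem mag_ext {φ ψ : Hom (Mag K) P} (h : φ.app 2 (magGen K) = ψ.app 2 (magGen K)) : φ = ψ := by
  refine Hom.ext (funext fun n => LinearMap.ext fun a => ?_)
  change Multilin K n at a
  induction a using multilin_induction with
  | zero => exact (map_zero (φ.app n)).trans (map_zero (ψ.app n)).symm
  | add f g hf hg =>
    exact (map_add (φ.app n) f g).trans ((congrArg₂ _ hf hg).trans (map_add (ψ.app n) f g).symm)
  | smul c f hf =>
    exact (map_smul (φ.app n) c f).trans ((congrArg _ hf).trans (map_smul (ψ.app n) c f).symm)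
  | mon t ht =>
    rw [← toOp_ofMonomial_magGen, ← toOp_mapLabelled, ← toOp_mapLabelled, mapLabelled_ofMonomial,
      mapLabelled_ofMonomial, h]

end Hom
end SymmOperad

/-! ### Morphisms from quotients -/

namespace SymmOperad

variable {K : Type u} [Field K] {P : SymmOperad.{u, v₁} K} {Q : SymmOperad.{u, v₂} K}

namespace Hom

/-- The kernel of a morphism, as an operad ideal. -/
def ker (φ : Hom P Q) : OperadIdeal P where
  carrier n := LinearMap.ker (φ.app n)
  act_mem σ a ha := by
    rw [LinearMap.mem_ker] at ha ⊢
    rw [φ.app_act, ha, map_zero]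
  comp_mem_left n a b ha := by
    rw [LinearMap.mem_ker] at ha ⊢
    rw [φ.app_comp, ha, map_zero, zero_apply]
  comp_mem_right n a b k hb := by
    rw [LinearMap.mem_ker] at hb ⊢
    rw [φ.app_comp]
    exact MultilinearMap.map_coord_zero _ k hb

/-- The kernel is one of the ideals containing `r` whose intersection is the ideal span. -/
theorem idealSpan_le_ker (φ : Hom P Q) {r : Set (Σ n, P.obj n)}
    (h : ∀ x ∈ r, φ.app x.1 x.2 = 0) (n : ℕ) :
    (P.idealSpan r).carrier n ≤ LinearMap.ker (φ.app n) := fun a ha => by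
  simp only [idealSpan, Submodule.mem_iInf] at ha
  exact ha φ.ker h

/-- The morphism from a quotient operad induced by a morphism that vanishes on the ideal. -/
noncomputable def quotientLift (φ : Hom P Q) (I : OperadIdeal P)
    (h : ∀ n, I.carrier n ≤ LinearMap.ker (φ.app n)) : Hom I.quotient Q where
  app n := (I.carrier n).liftQ (φ.app n) (h n)
  app_act σ a := by
    obtain ⟨a, rfl⟩ := (I.carrier _).mkQ_surjective a
    exact φ.app_act σ a
  app_one := φ.app_one
  app_comp n a b := by
    obtain ⟨a, rfl⟩ := (I.carrier _).mkQ_surjective a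
    choose b' hb' using fun i => (I.carrier (n i)).mkQ_surjective (b i)
    obtain rfl : (fun i => (I.carrier (n i)).mkQ (b' i)) = b := funext hb'
    exact (congrArg _ (I.quotientComp_mk n a b')).trans (φ.app_comp n a b')

/-- A morphism from a quotient of `Mag` is determined by the image of the generator. -/
theorem mag_quotient_ext {I : OperadIdeal (Mag K)} {φ ψ : Hom I.quotient P}
    (h : φ.app 2 (I.quotientHom.app 2 (magGen K)) = ψ.app 2 (I.quotientHom.app 2 (magGen K))) :
    φ = ψ := by
  have e : φ.comp I.quotientHom = ψ.comp I.quotientHom := mag_ext h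
  refine Hom.ext (funext fun n => LinearMap.ext fun a => ?_)
  obtain ⟨a, rfl⟩ := (I.carrier _).mkQ_surjective a
  exact LinearMap.congr_fun (congrFun (congrArg Hom.app e) n) a

theorem app_comp₂ (φ : Hom P Q) (p : P.obj 2) {k l : ℕ} (a : P.obj k) (b : P.obj l) :
    φ.app _ (P.comp₂ p a b) = Q.comp₂ (φ.app 2 p) (φ.app k a) (φ.app l b) := by
  rw [comp₂, comp₂, φ.app_act, φ.app_comp]
  congr 2
  funext i
  fin_cases i <;> rfl

theorem app_leftNested (φ : Hom P Q) (p : P.obj 2) :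
    φ.app 3 (P.leftNested p) = Q.leftNested (φ.app 2 p) :=
  (φ.app_comp₂ p p P.one).trans (congrArg _ φ.app_one)

theorem app_rightNested (φ : Hom P Q) (p : P.obj 2) :
    φ.app 3 (P.rightNested p) = Q.rightNested (φ.app 2 p) :=
  (φ.app_comp₂ p P.one p).trans (congrArg (fun a => Q.comp₂ _ a _) φ.app_one)

theorem app_opposite (φ : Hom P Q) (p : P.obj 2) :
    φ.app 2 (P.opposite p) = Q.opposite (φ.app 2 p) :=
  φ.app_act _ p

theorem app_jacobi (φ : Hom P Q) (p : P.obj 2) :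
    φ.app 3 (P.jacobi p) = Q.jacobi (φ.app 2 p) := by
  simp only [jacobi, map_add, φ.app_act, app_leftNested]

theorem app_lieAdmissibility (φ : Hom P Q) (p : P.obj 2) :
    φ.app 3 (P.lieAdmissibility p) = Q.lieAdmissibility (φ.app 2 p) := by
  simp only [lieAdmissibility, map_add, map_sub, φ.app_act, app_leftNested, app_rightNested]

end Hom

theorem opposite_add (p q : P.obj 2) : P.opposite (p + q) = P.opposite p + P.opposite q :=
  map_add _ p q

theorem opposite_sub (p q : P.obj 2) : P.opposite (p - q) = P.opposite p - P.opposite q :=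
  map_sub _ p q

theorem opposite_smul (c : K) (p : P.obj 2) : P.opposite (c • p) = c • P.opposite p :=
  map_smul _ c p

theorem opposite_opposite (p : P.obj 2) : P.opposite (P.opposite p) = p := by
  rw [opposite, opposite, ← P.act_trans, ← Equiv.Perm.mul_def, Equiv.swap_mul_self]
  exact P.act_refl p

end SymmOperad

/-! ### Lie-admissibility as a Jacobi identity -/

namespace Magmatic

variable {K : Type u} [Field K]

local notation "X" => FreeNonUnitalNonAssocAlgebra.of K

/-- Turns binary composition in `Mag` into explicit substitution, so that identities of arity 3 can
be checked by expansion in the free nonassociative algebra. -/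
theorem coe_comp₂ (p : Multilin K 2) {k l : ℕ} (a : Multilin K k) (b : Multilin K l) :
    ((Mag K).comp₂ p a b : Multilin K (k + l)).1 =
      subst ![rename K (Fin.castAdd l) a.1, rename K (Fin.natAdd k) b.1] p.1 := by
  refine (rename_subst _ _ _).trans (congrArg (fun g => subst g p.1) (funext fun i => ?_))
  refine (rename_rename _ _ _).trans ?_
  fin_cases i
  · refine congrArg (fun e => rename K e a.1) (funext fun j => Fin.ext ?_)
    simp
    rfl
  · refine congrArg (fun e => rename K e b.1) (funext fun j => Fin.ext ?_)
    simp
    rfl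

theorem coe_leftNested (p : Multilin K 2) : ((Mag K).leftNested p : Multilin K 3).1 =
    subst ![rename K (Fin.castAdd 1) p.1, X 2] p.1 := by
  refine (coe_comp₂ p p _).trans ?_
  congr 2
  exact congrArg (fun a => ![_, a]) (subst_of _ _)

theorem coe_rightNested (p : Multilin K 2) : ((Mag K).rightNested p : Multilin K 3).1 =
    subst ![X 0, rename K (Fin.natAdd 1) p.1] p.1 := by
  refine (coe_comp₂ p _ p).trans ?_
  congr 2
  exact congrArg (fun a => ![a, _]) (subst_of _ _)

theorem coe_magGen : (magGen K : Multilin K 2).1 = X 0 * X 1 := mon_mul _ _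

theorem coe_opposite_magGen : ((Mag K).opposite (magGen K) : Multilin K 2).1 = X 1 * X 0 := by
  change rename K _ (magGen K : Multilin K 2).1 = _
  rw [coe_magGen, map_mul, rename, subst_of, subst_of]
  rfl

theorem rename_of {Y Z : Type*} (e : Y → Z) (y : Y) : rename K e (X y) = X (e y) :=
  subst_of _ y

theorem coe_leftNested_magGen :
    ((Mag K).leftNested (magGen K) : Multilin K 3).1 = X 0 * X 1 * X 2 := by
  refine (coe_leftNested _).trans ?_
  rw [coe_magGen]
  simp only [map_mul, subst_of, rename_of]
  rfl

theorem coe_rightNested_magGen :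
    ((Mag K).rightNested (magGen K) : Multilin K 3).1 = X 0 * (X 1 * X 2) := by
  refine (coe_rightNested _).trans ?_
  rw [coe_magGen]
  simp only [map_mul, subst_of, rename_of]
  rfl

theorem coe_leftNested_commutator :
    ((Mag K).leftNested (magGen K - (Mag K).opposite (magGen K)) : Multilin K 3).1 =
      (X 0 * X 1 - X 1 * X 0) * X 2 - X 2 * (X 0 * X 1 - X 1 * X 0) := by
  have h : (magGen K - (Mag K).opposite (magGen K) : Multilin K 2).1 = X 0 * X 1 - X 1 * X 0 :=
    congrArg₂ (fun a b => a - b) coe_magGen coe_opposite_magGen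
  refine (coe_leftNested _).trans ?_
  rw [h]
  simp only [map_sub, map_mul, subst_of, rename_of]
  rfl

/-- The double commutator of the variables expands into four monomials, and its three cyclic
rotations give the twelve terms of the Lie-admissibility element. -/
theorem jacobi_commutator : (Mag K).jacobi (magGen K - (Mag K).opposite (magGen K)) =
    (Mag K).lieAdmissibility (magGen K) := by
  refine Subtype.ext ?_
  let l : Multilin K 3 := (Mag K).leftNested (magGen K)
  let r : Multilin K 3 := (Mag K).rightNested (magGen K)
  let c : Multilin K 3 := (Mag K).leftNested (magGen K - (Mag K).opposite (magGen K))
  have hl : l.1 = X 0 * X 1 * X 2 := coe_leftNested_magGen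
  have hr : r.1 = X 0 * (X 1 * X 2) := coe_rightNested_magGen
  have hc : c.1 = (X 0 * X 1 - X 1 * X 0) * X 2 - X 2 * (X 0 * X 1 - X 1 * X 0) :=
    coe_leftNested_commutator
  change c.1 + rename K c[(0 : Fin 3), 1, 2] c.1 + rename K c[(0 : Fin 3), 2, 1] c.1 =
    l.1 - rename K (Equiv.swap (0 : Fin 3) 1) l.1 - rename K c[(0 : Fin 3), 2, 1] r.1 +
      rename K (Equiv.swap (0 : Fin 3) 2) r.1 + rename K c[(0 : Fin 3), 1, 2] l.1 -
      rename K (Equiv.swap (0 : Fin 3) 2) l.1 - r.1 + rename K (Equiv.swap (1 : Fin 3) 2) r.1 +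
      rename K c[(0 : Fin 3), 2, 1] l.1 - rename K (Equiv.swap (1 : Fin 3) 2) l.1 -
      rename K c[(0 : Fin 3), 1, 2] r.1 + rename K (Equiv.swap (0 : Fin 3) 1) r.1
  rw [hl, hr, hc]
  -- The permutations are replaced by translations modulo 3 and by tables, which simplification can
  -- evaluate on the variables.
  have h012 : ∀ i : Fin 3, c[(0 : Fin 3), 1, 2] i = i + 1 := by decide
  have h021 : ∀ i : Fin 3, c[(0 : Fin 3), 2, 1] i = i + 2 := by decide
  have h01 : ∀ i : Fin 3, Equiv.swap (0 : Fin 3) 1 i = ![1, 0, 2] i := by decide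
  have h02 : ∀ i : Fin 3, Equiv.swap (0 : Fin 3) 2 i = ![2, 1, 0] i := by decide
  have h12 : ∀ i : Fin 3, Equiv.swap (1 : Fin 3) 2 i = ![0, 2, 1] i := by decide
  have e1 : (2 : Fin 3) + 1 = 0 := rfl
  have e2 : (1 : Fin 3) + 2 = 0 := rfl
  have e3 : (2 : Fin 3) + 2 = 1 := rfl
  have e4 : (1 : Fin 3) + 1 = 2 := rfl
  simp only [map_sub, map_mul, rename_of, h012, h021, h01, h02, h12, zero_add, e1, e2, e3, e4,
    Matrix.cons_val, sub_mul, mul_sub]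
  abel

end Magmatic

/-! ### `Lie-adm` as a free product -/

namespace SymmOperad

variable {K : Type u} [Field K]

/-- The Lie-admissibility element of an operation is the Jacobi element of its commutator. -/
theorem jacobi_sub_opposite {P : SymmOperad.{u, v} K} (p : P.obj 2) :
    P.jacobi (p - P.opposite p) = P.lieAdmissibility p := by
  -- The generic identity in `Mag` specializes to any `p` along the morphism sending the generator
  -- to `p`.
  have h := congrArg ((magLift p).app 3) (Magmatic.jacobi_commutator (K := K))
  rwa [Hom.app_jacobi, map_sub, Hom.app_opposite, Hom.app_lieAdmissibility, magLift_gen] at h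

/-! ### Universal properties of `Com`, `Lie` and `Lie-adm` -/

section Presentations

variable {P : SymmOperad.{u, v} K}

theorem exists_com_hom (p : P.obj 2) (hp : P.opposite p = p) :
    ∃ φ : Hom (Com K) P, φ.app 2 (comGen K) = p := by
  refine ⟨(magLift p).quotientLift _ ((magLift p).idealSpan_le_ker ?_), ?_⟩
  · rintro _ rfl
    rw [map_sub, Hom.app_opposite, magLift_gen, hp, sub_self]
  · exact magLift_gen p

theorem exists_lie_hom (p : P.obj 2) (hp : P.opposite p = -p) (hp' : P.jacobi p = 0) :
    ∃ φ : Hom (Lie K) P, φ.app 2 (lieGen K) = p := by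
  refine ⟨(magLift p).quotientLift _ ((magLift p).idealSpan_le_ker ?_), ?_⟩
  · rintro _ (rfl | rfl)
    · rw [map_add, Hom.app_opposite, magLift_gen, hp, neg_add_cancel]
    · rw [Hom.app_jacobi, magLift_gen, hp']
  · exact magLift_gen p

theorem exists_lieAdm_hom (p : P.obj 2) (hp : P.lieAdmissibility p = 0) :
    ∃ φ : Hom (LieAdm K) P, φ.app 2 (lieAdmGen K) = p := by
  refine ⟨(magLift p).quotientLift _ ((magLift p).idealSpan_le_ker ?_), ?_⟩
  · rintro _ rfl
    rw [Hom.app_lieAdmissibility, magLift_gen, hp]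
  · exact magLift_gen p

theorem com_hom_ext {φ ψ : Hom (Com K) P} (h : φ.app 2 (comGen K) = ψ.app 2 (comGen K)) :
    φ = ψ :=
  Hom.mag_quotient_ext h

theorem lie_hom_ext {φ ψ : Hom (Lie K) P} (h : φ.app 2 (lieGen K) = ψ.app 2 (lieGen K)) :
    φ = ψ :=
  Hom.mag_quotient_ext h

theorem lieAdm_hom_ext {φ ψ : Hom (LieAdm K) P}
    (h : φ.app 2 (lieAdmGen K) = ψ.app 2 (lieAdmGen K)) : φ = ψ :=
  Hom.mag_quotient_ext h

theorem quotientHom_eq_zero {Q : SymmOperad.{u, v₁} K} {r : Set (Σ n, Q.obj n)} {n : ℕ}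
    {a : Q.obj n} (h : ⟨n, a⟩ ∈ r) : (Q.idealSpan r).quotientHom.app n a = 0 := by
  refine (Submodule.Quotient.mk_eq_zero _).2 ?_
  simp only [idealSpan, Submodule.mem_iInf]
  exact fun I hI => hI _ h

theorem opposite_comGen : (Com K).opposite (comGen K) = comGen K := by
  refine sub_eq_zero.1 (Eq.trans ?_ (quotientHom_eq_zero (Set.mem_singleton _)))
  rw [map_sub, Hom.app_opposite]
  rfl

theorem opposite_lieGen : (Lie K).opposite (lieGen K) = -lieGen K := by
  refine eq_neg_of_add_eq_zero_left
    (Eq.trans ?_ (quotientHom_eq_zero (Set.mem_insert _ {Sigma.mk 3 ((Mag K).jacobi (magGen K))})))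
  rw [map_add, Hom.app_opposite]
  rfl

theorem jacobi_lieGen : (Lie K).jacobi (lieGen K) = 0 :=
  (Hom.app_jacobi _ _).symm.trans
    (quotientHom_eq_zero (Set.mem_insert_of_mem _ (Set.mem_singleton _)))

theorem lieAdmissibility_lieAdmGen : (LieAdm K).lieAdmissibility (lieAdmGen K) = 0 :=
  (Hom.app_lieAdmissibility _ _).symm.trans (quotientHom_eq_zero (Set.mem_singleton _))

end Presentations

theorem exists_lie_hom_lieAdm : ∃ φ : Hom (Lie K) (LieAdm K),
    φ.app 2 (lieGen K) = lieAdmGen K - (LieAdm K).opposite (lieAdmGen K) := by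
  refine exists_lie_hom _ ?_ ?_
  · rw [opposite_sub, opposite_opposite, neg_sub]
  · rw [jacobi_sub_opposite, lieAdmissibility_lieAdmGen]

theorem exists_com_hom_lieAdm : ∃ φ : Hom (Com K) (LieAdm K),
    φ.app 2 (comGen K) = lieAdmGen K + (LieAdm K).opposite (lieAdmGen K) := by
  refine exists_com_hom _ ?_
  rw [opposite_add, opposite_opposite, add_comm]

theorem isFreeProduct_lieAdm (h2 : (2 : K) ≠ 0) {φ₁ : Hom (Lie K) (LieAdm K)}
    {φ₂ : Hom (Com K) (LieAdm K)}
    (h₁ : φ₁.app 2 (lieGen K) = lieAdmGen K - (LieAdm K).opposite (lieAdmGen K))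
    (h₂ : φ₂.app 2 (comGen K) = lieAdmGen K + (LieAdm K).opposite (lieAdmGen K)) :
    IsFreeProduct.{u, u, w, u, u} φ₁ φ₂ := by
  intro P ψ₁ ψ₂
  have hm : P.opposite (ψ₁.app 2 (lieGen K)) = -ψ₁.app 2 (lieGen K) := by
    rw [← ψ₁.app_opposite, opposite_lieGen, map_neg]
  have hc : P.opposite (ψ₂.app 2 (comGen K)) = ψ₂.app 2 (comGen K) := by
    rw [← ψ₂.app_opposite, opposite_comGen]
  have hj : P.jacobi (ψ₁.app 2 (lieGen K)) = 0 := by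
    rw [← ψ₁.app_jacobi, jacobi_lieGen, map_zero]
  set m := ψ₁.app 2 (lieGen K)
  set c := ψ₂.app 2 (comGen K)
  -- The average of `m` and `c` is the only operation with commutator `m` and anticommutator `c`,
  -- hence the forced image of the generator of `Lie-adm`.
  have hsub : (2 : K)⁻¹ • (m + c) - P.opposite ((2 : K)⁻¹ • (m + c)) = m := by
    rw [opposite_smul, opposite_add, hm, hc, ← smul_sub, add_sub_add_right_eq_sub, sub_neg_eq_add,
      ← two_smul K, inv_smul_smul₀ h2]
  have hadd : (2 : K)⁻¹ • (m + c) + P.opposite ((2 : K)⁻¹ • (m + c)) = c := by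
    rw [opposite_smul, opposite_add, hm, hc, ← smul_add, add_add_add_comm, add_neg_cancel, zero_add,
      ← two_smul K, inv_smul_smul₀ h2]
  obtain ⟨ψ, hψ⟩ := exists_lieAdm_hom ((2 : K)⁻¹ • (m + c))
    (by rw [← jacobi_sub_opposite, hsub, hj])
  refine ⟨ψ, ⟨lie_hom_ext ?_, com_hom_ext ?_⟩, fun ψ' hψ' => lieAdm_hom_ext ?_⟩
  · change ψ.app 2 (φ₁.app 2 (lieGen K)) = m
    rw [h₁, map_sub, ψ.app_opposite, hψ, hsub]
  · change ψ.app 2 (φ₂.app 2 (comGen K)) = c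
    rw [h₂, map_add, ψ.app_opposite, hψ, hadd]
  -- Uniqueness: `x` is half the sum of `x - y` and `x + y`, whose images under `ψ'` are prescribed.
  · have e₁ : ψ'.app 2 (φ₁.app 2 (lieGen K)) = m :=
      congrArg (fun χ : Hom (Lie K) P => χ.app 2 (lieGen K)) hψ'.1
    have e₂ : ψ'.app 2 (φ₂.app 2 (comGen K)) = c :=
      congrArg (fun χ : Hom (Com K) P => χ.app 2 (comGen K)) hψ'.2
    rw [h₁, map_sub] at e₁
    rw [h₂, map_add] at e₂
    rw [hψ, ← e₁, ← e₂, sub_add_add_cancel, ← two_smul K, inv_smul_smul₀ h2]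

/-- Free products are unique up to isomorphism. -/
theorem IsFreeProduct.exists_isIso {O₁ : SymmOperad.{u, v₁} K} {O₂ : SymmOperad.{u, v₂} K}
    {O O' : SymmOperad.{u, v} K} {π₁ : Hom O₁ O} {π₂ : Hom O₂ O} {π₁' : Hom O₁ O'}
    {π₂' : Hom O₂ O'} (h : IsFreeProduct.{u, v, v, v₁, v₂} π₁ π₂)
    (h' : IsFreeProduct.{u, v, v, v₁, v₂} π₁' π₂') :
    ∃ ψ : Hom O O', ψ.IsIso ∧ ψ.comp π₁ = π₁' ∧ ψ.comp π₂ = π₂' := by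
  obtain ⟨ψ, ⟨h₁, h₂⟩, -⟩ := h O' π₁' π₂'
  obtain ⟨φ, ⟨h₁', h₂'⟩, -⟩ := h' O π₁ π₂
  refine ⟨ψ, ⟨φ, ?_, ?_⟩, h₁, h₂⟩
  -- The round trip and the identity both solve the universal problem of `O` mapping to itself, so
  -- they agree. The other composite is treated alike.
  · refine (h O π₁ π₂).unique ⟨?_, ?_⟩ ⟨rfl, rfl⟩
    · exact (congrArg φ.comp h₁).trans h₁'
    · exact (congrArg φ.comp h₂).trans h₂'
  · refine (h' O' π₁' π₂').unique ⟨?_, ?_⟩ ⟨rfl, rfl⟩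
    · exact (congrArg ψ.comp h₁').trans h₁
    · exact (congrArg ψ.comp h₂').trans h₂

end SymmOperad

theorem mainTheorem4 (K : Type u) [Field K] (hK : ringChar K ≠ 2) :
    (∃ (φ₁ : Hom (Lie K) (LieAdm K)) (φ₂ : Hom (Com K) (LieAdm K)),
      φ₁.app 2 (lieGen K) = lieAdmGen K - (LieAdm K).opposite (lieAdmGen K) ∧
      φ₂.app 2 (comGen K) = lieAdmGen K + (LieAdm K).opposite (lieAdmGen K) ∧
      IsFreeProduct.{u, u, w, u, u} φ₁ φ₂) ∧
    ∀ (O : SymmOperad.{u, u} K) (π₁ : Hom (Lie K) O) (π₂ : Hom (Com K) O),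
      IsFreeProduct.{u, u, u, u, u} π₁ π₂ →
      ∃ ψ : Hom O (LieAdm K), ψ.IsIso ∧
        ψ.app 2 (π₁.app 2 (lieGen K)) = lieAdmGen K - (LieAdm K).opposite (lieAdmGen K) ∧
        ψ.app 2 (π₂.app 2 (comGen K)) = lieAdmGen K + (LieAdm K).opposite (lieAdmGen K) := by
  have h2 : (2 : K) ≠ 0 := Ring.two_ne_zero hK
  obtain ⟨φ₁, h₁⟩ := exists_lie_hom_lieAdm (K := K)
  obtain ⟨φ₂, h₂⟩ := exists_com_hom_lieAdm (K := K)
  refine ⟨⟨φ₁, φ₂, h₁, h₂, isFreeProduct_lieAdm h2 h₁ h₂⟩, fun O π₁ π₂ hO => ?_⟩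
  -- The universal property of `Lie-adm` is used again, now tested only against operads in universe
  -- `u`, where `O` lives.
  obtain ⟨ψ, hψ, e₁, e₂⟩ := hO.exists_isIso (isFreeProduct_lieAdm h2 h₁ h₂)
  refine ⟨ψ, hψ, ?_, ?_⟩
  · rw [← h₁, ← e₁]
    rfl
  · rw [← h₂, ← e₂]
    rfl
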